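/- Let $R$ be a commutative ring and let $C(R)$ be the category of (possibly unbounded) cochain complexes of $R$-modules. A complex $A^\bullet\in C(R)$ is \emph{pure acyclic} if $N\otimes_R A^\bullet$ is acyclic for every $R$-module $N$, and a morphism of $C(R)$ is a \emph{pure quasi-isomorphism} if its mapping cone is pure acyclic. For $M^\bullet,N^\bullet\in C(R)$, $\mathrm{Hom}_R^\bullet(M^\bullet,N^\bullet)\in C(R)$ denotes the complex with $\mathrm{Hom}_R^i(M^\bullet,N^\bullet)=\prod_{j\in\mathbb Z}\mathrm{Hom}_R(M^j,N^{i+j})$ and $d^i(f)=d_N\circ f-(-1)^i f\circ d_M$. A complex $I^\bullet$ is \emph{$K$-pure injective} if $\mathrm{Hom}_R^\bullet(A^\bullet,I^\bullet)$ is pure acyclic for every pure acyclic $A^\bullet$; a module is \emph{pure injective} if it is $K$-pure injective as a complex concentrated in degree $0$. A \emph{pure injective resolution} of $M^\bullet$ is a pure quasi-isomorphism $g\colon M^\bullet\to I^\bullet$ such that $I^\bullet$ is a $K$-pure injective complex and every $I^j$ is a pure injective module. An inverse system $\{I_n^\bullet\}_{n\ge 0}$ in $C(R)$ is a \emph{special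 inverse system of $K$-pure injective complexes} if, with $I_{-1}^\bullet:=0$, for every $n\geq 0$ the map $I_n^\bullet\to I_{n-1}^\bullet$ is surjective, its kernel is $K$-pure injective, and the short exact sequence $0\to \mathrm{Ker}\to I_n^\bullet\to I_{n-1}^\bullet\to 0$ splits in each degree. Finally, $\tau^{\ge n}M^\bullet$ is the complex that is $M^i$ in degrees $i>n$, $\mathrm{Coker}(d^{n-1})$ in degree $n$ and $0$ in degrees $i<n$. \textbf{Theorem.} Every complex $M^\bullet\in C(R)$ has a pure injective resolution $g\colon M^\bullet\to I^\bullet$. Moreover, $g$ can be chosen as follows: there are a special inverse system $\{I_n^\bullet\}_{n\ge 0}$ of $K$-pure injective complexes and a morphism $\{f_n\colon \tau^{\ge -n}M^\bullet\to I_n^\bullet\}_{n\ge 0}$ of inverse systems such that, for every $n\geq 0$, $I_n^\bullet$ is bounded below and $f_n$ is a pure injective resolution of $\tau^{\ge -n}M^\bullet$, such that $I^\bullet=\varprojlim_{n\ge 0} I_n^\bullet$, and such that, for every $n\geq 0$, the composite of $g$ with the projection $I^\bullet\to I_n^\bullet$ is the composite $M^\bullet\to\tau^{\ge -n}M^\bullet\xrightarrow{f_n}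 I_n^\bullet$. -/

import Mathlib

open CategoryTheory CategoryTheory.Limits

universe u

namespace PureRes

/-- The category `C(R)` of (unbounded) cochain complexes of `R`-modules. -/
abbrev Cplx (R : Type u) [CommRing R] := CochainComplex (ModuleCat.{u} R) ℤ

section

variable {R : Type u} [CommRing R]

/-- The complex `N ⊗_R M^•` for a module `N` and a complex `M^•`. -/
noncomputable def tensorCplx (N : ModuleCat.{u} R) (M : Cplx R) : Cplx R :=
  ((MonoidalCategory.tensorLeft N).mapHomologicalComplex (ComplexShape.up ℤ)).obj M

/-- A complex is pure acyclic if it stays acyclic after tensoring with any module. -/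
def IsPureAcyclic (M : Cplx R) : Prop :=
  ∀ N : ModuleCat.{u} R, (tensorCplx N M).Acyclic

/-- A morphism of complexes is a pure quasi-isomorphism if its mapping cone is pure acyclic. -/
def IsPureQuasiIso {M N : Cplx R} (f : M ⟶ N) : Prop :=
  IsPureAcyclic (CochainComplex.mappingCone f)

/-- The internal Hom complex of `R`-modules: in degree `i` it is `∏_j Hom_R(M^j, N^{i+j})`, and
its differential is `f ↦ d_N ∘ f - (-1)^i f ∘ d_M`. -/
noncomputable def homCplx (M N : Cplx R) : Cplx R where
  X i := ModuleCat.of R (CochainComplex.HomComplex.Cochain M N i)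
  d i j := ModuleCat.ofHom (CochainComplex.HomComplex.δ_hom R M N i j)
  shape i j hij := by
    refine ModuleCat.hom_ext (LinearMap.ext fun z => ?_)
    exact CochainComplex.HomComplex.δ_shape i j hij z
  d_comp_d' i j k _ _ := by
    refine ModuleCat.hom_ext (LinearMap.ext fun z => ?_)
    exact CochainComplex.HomComplex.δ_δ i j k z

/-- A complex `I^•` is `K`-pure injective if the functor `Hom_R^•(_, I^•)` takes pure acyclic
complexes to pure acyclic complexes. -/
def IsKPureInjective (I : Cplx R) : Prop :=
  ∀ A : Cplx R, IsPureAcyclic A → IsPureAcyclic (homCplx A I)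

/-- A module `E` is pure injective if the functor `Hom_R^•(_, E)` preserves pure acyclic
complexes, where `E` is seen as a complex concentrated in degree `0`. -/
def IsPureInjective (E : ModuleCat.{u} R) : Prop :=
  ∀ A : Cplx R, IsPureAcyclic A →
    IsPureAcyclic (homCplx A ((CochainComplex.singleFunctor (ModuleCat.{u} R) 0).obj E))

/-- A morphism `g : M^• ⟶ I^•` is a pure injective resolution of `M^•`. -/
structure IsPureInjectiveResolution {M I : Cplx R} (g : M ⟶ I) : Prop where
  pureInjective : ∀ i : ℤ, IsPureInjective (I.X i)
  pureQuasiIso : IsPureQuasiIso g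
  kPureInjective : IsKPureInjective I

/-- `I^•` is bounded below: `I^i` vanishes for all sufficiently small `i`. -/
def IsBoundedBelow (I : Cplx R) : Prop :=
  ∃ a : ℤ, ∀ i : ℤ, i < a → IsZero (I.X i)

/-- The transition morphism `I_{n+1}^• ⟶ I_n^•` of an inverse system of complexes. -/
abbrev transition (I : ℕᵒᵖ ⥤ Cplx R) (n : ℕ) :
    I.obj (Opposite.op (n + 1)) ⟶ I.obj (Opposite.op n) :=
  I.map (homOfLE n.le_succ).op

/-- The sequence `Ker p ⟶ X^• ⟶ Y^•` of complexes attached to `p : X^• ⟶ Y^•`. -/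
noncomputable def kernelSequence {X Y : Cplx R} (p : X ⟶ Y) : ShortComplex (Cplx R) :=
  ShortComplex.mk (kernel.ι p) p (kernel.condition p)

/-- An inverse system `{I_n^•}_{n ≥ 0}` of complexes is `T`-special if, for all `n ≥ 0`, the map
`I_n^• ⟶ I_{n-1}^•` is surjective, its kernel is in `T`, and the resulting short exact sequence
is split in each degree. Here `I_{-1}^• = 0`, so that the conditions for `n = 0` say precisely
that `I_0^•` is in `T`. -/
structure IsSpecialInverseSystem (T : Cplx R → Prop) (I : ℕᵒᵖ ⥤ Cplx R) : Prop where
  zero : T (I.obj (Opposite.op 0))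
  surjective : ∀ (n : ℕ) (i : ℤ), Function.Surjective ((transition I n).f i)
  kernel_mem : ∀ n : ℕ, T (kernel (transition I n))
  semiSplit : ∀ (n : ℕ) (i : ℤ), Nonempty
    ((kernelSequence (transition I n)).map
      (HomologicalComplex.eval (ModuleCat.{u} R) (ComplexShape.up ℤ) i)).Splitting

/-- The canonical morphism `τ^{≥ m} M^• ⟶ τ^{≥ n} M^•` for `m ≤ n`. As `τ^{≥ n} M^•` vanishes
in degrees `< m`, it is canonically isomorphic to `τ^{≥ m} τ^{≥ n} M^•`. -/
noncomputable def truncTransition (M : Cplx R) {m n : ℤ} (h : m ≤ n) :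
    M.truncGE m ⟶ M.truncGE n :=
  haveI : (M.truncGE n).IsStrictlyGE m := (M.truncGE n).isStrictlyGE_of_ge m n h
  CochainComplex.truncGEMap (M.πTruncGE n) m ≫ inv ((M.truncGE n).πTruncGE m)

/-- The morphism `τ^{≥ m} M^• ⟶ τ^{≥ n} M^•` is compatible with the projections from `M^•`. -/
lemma π_truncTransition (M : Cplx R) {m n : ℤ} (h : m ≤ n) :
    M.πTruncGE m ≫ truncTransition M h = M.πTruncGE n := by
  have : (M.truncGE n).IsStrictlyGE m := (M.truncGE n).isStrictlyGE_of_ge m n h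
  rw [truncTransition, ← Category.assoc, CochainComplex.πTruncGE_naturality, Category.assoc,
    IsIso.hom_inv_id, Category.comp_id]

instance epi_πTruncGE (M : Cplx R) (n : ℤ) : Epi (M.πTruncGE n) :=
  inferInstanceAs (Epi (HomologicalComplex.πTruncGE M (ComplexShape.embeddingUpIntGE n)))

/-- The inverse system `{τ^{≥ -n} M^•}_{n ≥ 0}`. -/
noncomputable def truncSystem (M : Cplx R) : ℕᵒᵖ ⥤ Cplx R where
  obj n := M.truncGE (-(n.unop : ℤ))
  map {a b} f := truncTransition M (by have := f.unop.le; omega)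
  map_id a := by
    rw [← cancel_epi (M.πTruncGE _), π_truncTransition, Category.comp_id]
  map_comp f g := by
    rw [← cancel_epi (M.πTruncGE _), π_truncTransition, ← Category.assoc, π_truncTransition,
      π_truncTransition]

end

end PureRes

/-! The working notion is a lifting one: a complex is Hom-exact if it is exact after `Hom(P, _)` for
every finitely presented `P`. By `lTensor_exact_of_homExact` this implies pure acyclicity, for
unbounded complexes too; the converse is never needed. Pure quasi-isomorphisms are therefore
produced by solving lifting problems (`IsHomQuasiIso`). Dually, `IsKPI` only asks that Hom out of
pure acyclic complexes be acyclic; since `Hom(P, Hom(A, I)) = Hom(P ⊗ A, I)` and `P ⊗ A` is again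
pure acyclic, the Hom complexes are then Hom-exact, hence pure acyclic (`IsKPI.isKPureInjective`).

Character modules are pure injective, and a module is pure in its double character module. Iterating
termwise cokernels of these embeddings and totalizing resolves any bounded below complex
(`exists_resolution`). The result is K-pure injective because homotopies into a bounded below
complex of pure injectives can be built degree by degree (`isKPI_of_isBoundedBelow`).

For general `M`, the truncations are resolved one after the other. A mapping fibre construction
(`exists_factorization`) makes each transition map of the tower of resolutions a degreewise split
epimorphism. A Mittag-Leffler argument (`exists_compatible_preimages`) then passes three properties
to the limit: pure injectivity of the terms, K-pure injectivity, and the resolution property. For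
the last one, the truncations agree with `M` in any given range of degrees from some stage on. -/

namespace PureRes

open TensorProduct

/-! ### Exactness against finitely presented modules implies exactness of tensor products. -/

section Tensor

variable {R : Type u} [CommRing R]

/-- Exactness of `A ⟶ B ⟶ C` at `B` after applying `Hom(P, _)`, for all finitely presented `P`. -/
def HomExact {A B C : Type u} [AddCommGroup A] [AddCommGroup B] [AddCommGroup C]
    [Module R A] [Module R B] [Module R C] (f : A →ₗ[R] B) (g : B →ₗ[R] C) : Prop :=
  ∀ (P : Type u) [AddCommGroup P] [Module R P] [Module.FinitePresentation R P]
    (x : P →ₗ[R] B), g ∘ₗ x = 0 → ∃ y : P →ₗ[R] A, f ∘ₗ y = x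

lemma HomExact.exists_eq {A B C : Type u} [AddCommGroup A] [AddCommGroup B] [AddCommGroup C]
    [Module R A] [Module R B] [Module R C] {f : A →ₗ[R] B} {g : B →ₗ[R] C} (h : HomExact f g)
    (b : B) (hb : g b = 0) : ∃ a, f a = b := by
  obtain ⟨y, hy⟩ := h R (LinearMap.toSpanSingleton R B b) (by ext; simp [hb])
  exact ⟨y 1, by simpa using LinearMap.congr_fun hy 1⟩

/-- A tuple satisfying the relations `a` is a map out of the finitely presented module `R^k / span
a`, so it lifts together with its relations. -/
lemma HomExact.exists_eq_of_relations {A B C : Type u} [AddCommGroup A] [AddCommGroup B]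
    [AddCommGroup C] [Module R A] [Module R B] [Module R C] {f : A →ₗ[R] B} {g : B →ₗ[R] C}
    (h : HomExact f g) {r k : ℕ} (a : Fin r → Fin k → R) (b : Fin k → B)
    (hb : ∀ j, g (b j) = 0) (hab : ∀ i, ∑ j, a i j • b j = 0) :
    ∃ w : Fin k → A, (∀ j, f (w j) = b j) ∧ ∀ i, ∑ j, a i j • w j = 0 := by
  let S : Submodule R (Fin k → R) := Submodule.span R (Set.range a)
  have hS : S.FG := Submodule.fg_span (Set.finite_range a)
  have : Module.FinitePresentation R ((Fin k → R) ⧸ S) :=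
    Module.finitePresentation_of_surjective S.mkQ S.mkQ_surjective (by rwa [S.ker_mkQ])
  have hker : S ≤ LinearMap.ker (Fintype.linearCombination R b) := by
    refine Submodule.span_le.2 ?_
    rintro _ ⟨i, rfl⟩
    simpa [Fintype.linearCombination_apply] using hab i
  obtain ⟨y, hy⟩ := h _ (S.liftQ _ hker) (by
    ext j
    simp [Fintype.linearCombination_apply, Pi.single_apply, hb])
  refine ⟨fun j ↦ y (S.mkQ (Pi.single j 1)), fun j ↦ ?_, fun i ↦ ?_⟩
  · have := LinearMap.congr_fun hy (S.mkQ (Pi.single j 1))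
    simpa [Fintype.linearCombination_apply, Pi.single_apply] using this
  · have h0 : S.mkQ (a i) = 0 :=
      (Submodule.Quotient.mk_eq_zero S).2 (Submodule.subset_span ⟨i, rfl⟩)
    have h1 : a i = ∑ j, a i j • (Pi.single j 1 : Fin k → R) := by
      simp [← pi_eq_sum_univ']
    rw [← map_zero y, ← h0]
    conv_rhs => rw [h1]
    simp only [map_sum, map_smul]

lemma exists_sum_tmul_of_span_eq_top {Q X : Type u} [AddCommGroup Q] [Module R Q]
    [AddCommGroup X] [Module R X] {r : ℕ} {s : Fin r → Q}
    (hs : Submodule.span R (Set.range s) = ⊤) (z : Q ⊗[R] X) :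
    ∃ x : Fin r → X, z = ∑ i, s i ⊗ₜ[R] x i := by
  induction z with
  | zero => exact ⟨0, by simp⟩
  | add z z' h h' =>
    obtain ⟨x, rfl⟩ := h
    obtain ⟨x', rfl⟩ := h'
    exact ⟨x + x', by simp [tmul_add, Finset.sum_add_distrib]⟩
  | tmul q x =>
    obtain ⟨c, rfl⟩ := (Submodule.mem_span_range_iff_exists_fun R).1 (hs ▸ Submodule.mem_top : q ∈ _)
    exact ⟨fun i ↦ c i • x, by simp [sum_tmul, smul_tmul]⟩

/-- If `X₁ ⟶ X₂ ⟶ X₃ ⟶ X₄ ⟶ X₅` is exact after applying `Hom(P, _)` for all finitely presented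
modules `P`, then it is exact at `X₂` after tensoring with any module. -/
lemma lTensor_exact_of_homExact {N X₁ X₂ X₃ X₄ X₅ : Type u} [AddCommGroup N] [AddCommGroup X₁]
    [AddCommGroup X₂] [AddCommGroup X₃] [AddCommGroup X₄] [AddCommGroup X₅] [Module R N]
    [Module R X₁] [Module R X₂] [Module R X₃] [Module R X₄] [Module R X₅]
    {d₁ : X₁ →ₗ[R] X₂} {d₂ : X₂ →ₗ[R] X₃} {d₃ : X₃ →ₗ[R] X₄} {d₄ : X₄ →ₗ[R] X₅}
    (h₂ : HomExact d₁ d₂) (h₃ : HomExact d₂ d₃) (h₄ : HomExact d₃ d₄)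
    (w₃ : d₃ ∘ₗ d₂ = 0) (w₄ : d₄ ∘ₗ d₃ = 0)
    (z : N ⊗[R] X₂) (hz : d₂.lTensor N z = 0) : ∃ y, d₁.lTensor N y = z := by
  -- Shrink `N` to a finitely generated submodule `Q` over which `z` is defined and its image under
  -- `d₂` already vanishes, so that the equational criterion for vanishing applies to generators of
  -- `Q`.
  obtain ⟨N', hN', t, ht⟩ := Submodule.exists_fg_le_eq_rTensor_subtype z
  obtain ⟨Q, hQ, hQfg, h0⟩ := TensorProduct.eq_zero_of_fg_of_subtype_eq_zero hN'
    (t := d₂.lTensor N' t) (by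
      rw [← hz, ht, ← LinearMap.comp_apply, ← LinearMap.comp_apply,
        LinearMap.rTensor_comp_lTensor, LinearMap.lTensor_comp_rTensor])
  have : Module.Finite R Q := Module.Finite.iff_fg.2 hQfg
  obtain ⟨r, s, hs⟩ := Module.Finite.exists_fin (R := R) (M := Q)
  obtain ⟨x, hx⟩ := exists_sum_tmul_of_span_eq_top hs ((Submodule.inclusion hQ).rTensor X₂ t)
  have hzx : z = ∑ i, (s i : N) ⊗ₜ[R] x i := by
    have : z = Q.subtype.rTensor X₂ ((Submodule.inclusion hQ).rTensor X₂ t) := by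
      rw [ht, ← LinearMap.comp_apply, ← LinearMap.rTensor_comp, Submodule.subtype_comp_inclusion]
    rw [this, hx]
    simp
  have hdx : ∑ i, s i ⊗ₜ[R] d₂ (x i) = 0 := by
    rw [← h0, ← LinearMap.comp_apply, LinearMap.rTensor_comp_lTensor,
      ← LinearMap.lTensor_comp_rTensor, LinearMap.comp_apply, hx]
    simp
  obtain ⟨k, a, y, hy, hsa⟩ := TensorProduct.vanishesTrivially_of_sum_tmul_eq_zero R hs hdx
  -- The criterion gives `d₂ xᵢ = ∑ aᵢⱼ yⱼ` with `∑ᵢ aᵢⱼ sᵢ = 0`. The `yⱼ` need not be cycles;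
  -- subtracting `wⱼ`, which has the same image under `d₃` and satisfies the relations `a`, makes
  -- them cycles without changing the sums.
  obtain ⟨w, hw, haw⟩ := h₄.exists_eq_of_relations a (fun j ↦ d₃ (y j))
    (fun j ↦ LinearMap.congr_fun w₄ (y j)) (fun i ↦ by
      simp only [← map_smul, ← map_sum, ← hy]
      exact LinearMap.congr_fun w₃ (x i))
  choose v hv using fun j ↦ h₃.exists_eq (y j - w j) (by simp [hw])
  choose q hq using fun i ↦ h₂.exists_eq (x i - ∑ j, a i j • v j) (by
    simp [hv, smul_sub, Finset.sum_sub_distrib, haw, hy])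
  refine ⟨∑ i, (s i : N) ⊗ₜ[R] q i, ?_⟩
  have hv0 : ∑ i, (s i : N) ⊗ₜ[R] (∑ j, a i j • v j) = 0 := by
    refine TensorProduct.sum_tmul_eq_zero_of_vanishesTrivially R ⟨k, a, v, fun _ ↦ rfl, fun j ↦ ?_⟩
    simpa using congr_arg Q.subtype (hsa j)
  simp [hq, tmul_sub, Finset.sum_sub_distrib, hv0, hzx]

end Tensor

end PureRes

namespace PureRes

open TensorProduct CochainComplex CochainComplex.HomComplex

/-! ### Lifting criteria for pure quasi-isomorphisms and K-pure injectivity. -/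

section Complexes

variable {R : Type u} [CommRing R]

/-- A complex which is exact after applying `Hom(P, _)`, for all finitely presented `P`. -/
def IsHomExact (X : Cplx R) : Prop :=
  ∀ (P : ModuleCat.{u} R) [Module.FinitePresentation R P] (i j k : ℤ), i + 1 = j → j + 1 = k →
    ∀ x : P ⟶ X.X j, x ≫ X.d j k = 0 → ∃ y : P ⟶ X.X i, y ≫ X.d i j = x

lemma IsHomExact.homExact {X : Cplx R} (hX : IsHomExact X) {i j k : ℤ} (hij : i + 1 = j)
    (hjk : j + 1 = k) : HomExact (X.d i j).hom (X.d j k).hom := by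
  intro P _ _ _ x hx
  obtain ⟨y, hy⟩ := hX (ModuleCat.of R P) i j k hij hjk (ModuleCat.ofHom x)
    (ModuleCat.hom_ext hx)
  exact ⟨y.hom, congr_arg ModuleCat.Hom.hom hy⟩

lemma acyclic_iff_forall (X : Cplx R) : X.Acyclic ↔ ∀ i j k : ℤ, i + 1 = j → j + 1 = k →
    ∀ x : X.X j, X.d j k x = 0 → ∃ y : X.X i, X.d i j y = x := by
  refine ⟨fun h i j k hij hjk ↦ ?_, fun h j ↦ ?_⟩
  · have := h j
    rw [X.exactAt_iff' i j k (by simp; lia) (by simp; lia), ShortComplex.moduleCat_exact_iff] at this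
    exact this
  · rw [X.exactAt_iff' (j - 1) j (j + 1) (by simp) (by simp), ShortComplex.moduleCat_exact_iff]
    exact h _ _ _ (by lia) rfl

lemma isPureAcyclic_iff_forall (X : Cplx R) : IsPureAcyclic X ↔
    ∀ (N : ModuleCat.{u} R) (i j k : ℤ), i + 1 = j → j + 1 = k → ∀ z : N ⊗[R] X.X j,
      (X.d j k).hom.lTensor N z = 0 → ∃ y, (X.d i j).hom.lTensor N y = z :=
  forall_congr' fun _ ↦ acyclic_iff_forall _

lemma IsHomExact.isPureAcyclic {X : Cplx R} (hX : IsHomExact X) : IsPureAcyclic X := by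
  rw [isPureAcyclic_iff_forall]
  intro N i j k hij hjk z hz
  exact lTensor_exact_of_homExact (hX.homExact hij hjk) (hX.homExact hjk rfl)
    (hX.homExact (k := k + 1 + 1) rfl rfl)
    (by rw [← ModuleCat.hom_comp, X.d_comp_d]; rfl)
    (by rw [← ModuleCat.hom_comp, X.d_comp_d]; rfl) z hz

/-- The condition that the mapping cone of `f` is exact after applying `Hom(P, _)` for
all finitely presented `P`, expressed componentwise. -/
def IsHomQuasiIso {M N : Cplx R} (f : M ⟶ N) : Prop :=
  ∀ (P : ModuleCat.{u} R) [Module.FinitePresentation R P] (i j k l : ℤ), i + 1 = j → j + 1 = k →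
    k + 1 = l → ∀ (x : P ⟶ M.X k) (y : P ⟶ N.X j), x ≫ M.d k l = 0 →
      x ≫ f.f k + y ≫ N.d j k = 0 → ∃ (x' : P ⟶ M.X j) (y' : P ⟶ N.X i),
        x' ≫ M.d j k = -x ∧ x' ≫ f.f j + y' ≫ N.d i j = y

lemma IsHomQuasiIso.isPureQuasiIso {M N : Cplx R} {f : M ⟶ N} (hf : IsHomQuasiIso f) :
    IsPureQuasiIso f := by
  refine IsHomExact.isPureAcyclic fun P _ i j k hij hjk z hz ↦ ?_
  have hx := hz =≫ (mappingCone.fst f).1.v k (k + 1) rfl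
  have hy := hz =≫ (mappingCone.snd f).v k k (add_zero k)
  rw [Category.assoc, mappingCone.d_fst_v _ _ _ _ hjk rfl, zero_comp, Preadditive.comp_neg,
    neg_eq_zero, ← Category.assoc] at hx
  rw [Category.assoc, mappingCone.d_snd_v _ _ _ hjk, zero_comp, Preadditive.comp_add,
    ← Category.assoc, ← Category.assoc] at hy
  obtain ⟨x', y', h₁, h₂⟩ := hf P i j k (k + 1) hij hjk rfl _ _ hx hy
  refine ⟨x' ≫ (mappingCone.inl f).v j i (by lia) + y' ≫ (mappingCone.inr f).f i, ?_⟩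
  apply mappingCone.ext_to f j k hjk
  · simp [mappingCone.d_fst_v _ _ _ _ hij hjk, h₁]
  · simp [mappingCone.d_snd_v _ _ _ hij, h₂]

/-- `Hom(_, E)` turns pure acyclic complexes into acyclic ones. -/
def IsPI (E : ModuleCat.{u} R) : Prop :=
  ∀ (A : Cplx R), IsPureAcyclic A → ∀ (i j k : ℤ), i + 1 = j → j + 1 = k →
    ∀ φ : A.X j ⟶ E, A.d i j ≫ φ = 0 → ∃ ψ : A.X k ⟶ E, A.d j k ≫ ψ = φ

/-- `Hom(_, I)` turns pure acyclic complexes into acyclic ones. -/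
def IsKPI (I : Cplx R) : Prop :=
  ∀ (A : Cplx R), IsPureAcyclic A → ∀ (m n k : ℤ), m + 1 = n → n + 1 = k →
    ∀ z : Cochain A I n, δ n k z = 0 → ∃ α : Cochain A I m, δ m n α = z

lemma IsPI.of_retract {E E' : ModuleCat.{u} R} (hE : IsPI E) (i : E' ⟶ E) (r : E ⟶ E')
    (h : i ≫ r = 𝟙 E') : IsPI E' := by
  intro A hA a b c hab hbc φ hφ
  obtain ⟨ψ, hψ⟩ := hE A hA a b c hab hbc (φ ≫ i) (by rw [← Category.assoc, hφ, zero_comp])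
  exact ⟨ψ ≫ r, by rw [← Category.assoc, hψ, Category.assoc, h, Category.comp_id]⟩

lemma IsPureAcyclic.tensorCplx {A : Cplx R} (hA : IsPureAcyclic A) (N : ModuleCat.{u} R) :
    IsPureAcyclic (tensorCplx N A) := by
  rw [isPureAcyclic_iff_forall] at hA ⊢
  intro N' i j k hij hjk z hz
  have key (a b : ℤ) (t : N' ⊗[R] (N ⊗[R] A.X a)) :
      (A.d a b).hom.lTensor (N' ⊗[R] N) ((TensorProduct.assoc R N' N (A.X a)).symm t) =
        (TensorProduct.assoc R N' N (A.X b)).symm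
          (((A.d a b).hom.lTensor N).lTensor N' t) := by
    rw [LinearMap.lTensor_tensor]
    simp
  obtain ⟨y, hy⟩ := hA (ModuleCat.of R (N' ⊗[R] N)) i j k hij hjk
    ((TensorProduct.assoc R N' N (A.X j)).symm z) (by
      refine (key j k z).trans ?_
      refine (congr_arg _ hz).trans (map_zero _))
  refine ⟨TensorProduct.assoc R N' N (A.X i) y, ?_⟩
  apply (TensorProduct.assoc R N' N (A.X j)).symm.injective
  refine (key i j _).symm.trans ?_
  rw [LinearEquiv.symm_apply_apply]
  exact hy

lemma δ_v_apply {A I : Cplx R} {n k : ℤ} (hnk : n + 1 = k) (z : Cochain A I n) (p q q₁ q₂ : ℤ)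
    (hpq : p + k = q) (hq₁ : p + n = q₁) (hq₂ : p + 1 = q₂) (a : A.X p) :
    (δ n k z).v p q hpq a = I.d q₁ q (z.v p q₁ hq₁ a) +
      k.negOnePow • z.v q₂ q (by lia) (A.d p q₂ a) := by
  rw [δ_v n k hnk z p q hpq q₁ q₂ (by lia) hq₂]
  simp

/-- A map from `P` to the cocycles of `Hom(A, I)` uncurries to a cocycle `P ⊗ A ⟶ I`. As `P ⊗ A` is
pure acyclic, this is a coboundary, and currying a bounding cochain gives the lift. -/
lemma IsKPI.isKPureInjective {I : Cplx R} (hI : IsKPI I) : IsKPureInjective I := by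
  intro A hA
  refine IsHomExact.isPureAcyclic fun P _ m n k hmn hnk x hx ↦ ?_
  let X : P →ₗ[R] Cochain A I n := x.hom
  let z : Cochain (tensorCplx P A) I n := Cochain.mk fun p q hpq ↦
    ModuleCat.ofHom (TensorProduct.lift
      { toFun := fun t ↦ ((X t).v p q hpq).hom
        map_add' := fun s t ↦ by rw [map_add]; rfl
        map_smul' := fun r t ↦ by rw [map_smul]; rfl })
  have hδ : δ n k z = 0 := by
    refine Cochain.ext _ _ fun p q hpq ↦ ModuleCat.hom_ext (TensorProduct.ext' fun t a ↦ ?_)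
    have hX : δ n k (X t) = 0 := ConcreteCategory.congr_hom hx t
    exact (δ_v_apply hnk z p q _ _ hpq rfl rfl _).trans
      ((δ_v_apply hnk (X t) p q _ _ hpq rfl rfl a).symm.trans
        (ConcreteCategory.congr_hom (Cochain.congr_v hX p q hpq) a))
  obtain ⟨α, hα⟩ := hI _ (hA.tensorCplx P) m n k hmn hnk z hδ
  let y (t : P) : Cochain A I m := Cochain.mk fun p q hpq ↦ ModuleCat.ofHom
        ((α.v p q hpq).hom ∘ₗ TensorProduct.mk R P (A.X p) t)
  have hy : ∀ t, δ m n (y t) = X t := fun t ↦ by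
    refine Cochain.ext _ _ fun p q hpq ↦ ModuleCat.hom_ext (LinearMap.ext fun a ↦ ?_)
    exact (δ_v_apply hmn (y t) p q _ _ hpq rfl rfl a).trans
      ((δ_v_apply hmn α p q _ _ hpq rfl rfl _).symm.trans
        (ConcreteCategory.congr_hom (Cochain.congr_v hα p q hpq) (t ⊗ₜ[R] a)))
  refine ⟨ModuleCat.ofHom (Y := Cochain A I m)
    { toFun := y
      map_add' := fun s t ↦ ?_
      map_smul' := fun r t ↦ ?_ }, ModuleCat.hom_ext (LinearMap.ext hy)⟩
  · refine Cochain.ext _ _ fun p q hpq ↦ ModuleCat.hom_ext (LinearMap.ext fun a ↦ ?_)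
    exact (congr_arg _ (TensorProduct.add_tmul s t a)).trans 
      (map_add (α.v p q hpq).hom (s ⊗ₜ[R] a) (t ⊗ₜ[R] a))
  · refine Cochain.ext _ _ fun p q hpq ↦ ModuleCat.hom_ext (LinearMap.ext fun a ↦ ?_)
    exact map_smul (α.v p q hpq).hom r (t ⊗ₜ[R] a)

lemma IsPI.of_isZero {E : ModuleCat.{u} R} (hE : IsZero E) : IsPI E :=
  fun _ _ _ _ _ _ _ _ _ ↦ ⟨0, hE.eq_of_tgt _ _⟩

/-- The induction step in contracting a cocycle. The defect `u` in source degree `p₁` is killed by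
precomposition with the differential of `K`, by the cocycle condition and agreement at `p₀`. Pure
injectivity factors it through `K.X (p₁ + 1)`. A correction supported there does not affect
coboundaries in source degrees below `p₁`. -/
lemma exists_single_eqUpTo {K L : Cplx R} (hK : IsPureAcyclic K) (hL : ∀ i, IsPI (L.X i))
    {m n k : ℤ} (hmn : m + 1 = n) (hnk : n + 1 = k) (z : Cochain K L n) (hz : δ n k z = 0)
    (α : Cochain K L m) (p₀ p₁ : ℤ) (hp : p₀ + 1 = p₁) (hα : (δ m n α).EqUpTo z p₀) :
    ∃ h : K.X (p₁ + 1) ⟶ L.X (p₁ + n), (δ m n (α + Cochain.single h m)).EqUpTo z p₁ := by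
  subst hp hmn
  let u := z.v (p₀ + 1) _ rfl - α.v (p₀ + 1) (p₀ + 1 + m) rfl ≫ L.d _ (p₀ + 1 + (m + 1)) -
    (m + 1).negOnePow • K.d (p₀ + 1) (p₀ + 1 + 1) ≫ α.v (p₀ + 1 + 1) _ (by lia)
  have hu : K.d p₀ (p₀ + 1) ≫ u = 0 := by
    have e₁ := hα p₀ (p₀ + 1 + m) (by lia) le_rfl
    have e₂ := Cochain.congr_v hz p₀ (p₀ + 1 + (m + 1)) (by lia)
    rw [δ_v _ _ rfl _ _ _ _ (p₀ + m) (p₀ + 1) (by lia) rfl] at e₁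
    rw [δ_v _ _ hnk _ _ _ _ (p₀ + 1 + m) (p₀ + 1) (by lia) rfl, ← e₁] at e₂
    simp only [← hnk, Int.negOnePow_succ, Preadditive.add_comp, Category.assoc,
      HomologicalComplex.d_comp_d, comp_zero, zero_add, Linear.units_smul_comp, Units.neg_smul,
      Preadditive.neg_comp, neg_neg, Cochain.zero_v, neg_add_eq_zero, smul_left_cancel_iff] at e₂
    simp only [u, Preadditive.comp_sub, Linear.comp_units_smul,
      HomologicalComplex.d_comp_d_assoc, zero_comp, smul_zero, sub_zero]
    rw [e₂, sub_self]
  obtain ⟨β, hβ⟩ := hL _ K hK _ _ _ rfl rfl u hu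
  refine ⟨(m + 1).negOnePow • β, fun p q hpq hp ↦ ?_⟩
  rw [δ_add, Cochain.add_v]
  obtain hp | rfl := hp.lt_or_eq
  · rw [hα p q hpq (by lia), add_eq_left, δ_v _ _ rfl _ p q hpq (p + m) (p + 1) (by lia) rfl,
      Cochain.single_v_eq_zero _ _ _ _ _ (by lia),
      Cochain.single_v_eq_zero _ _ _ _ _ (by lia)]
    simp
  · obtain rfl := hpq
    rw [δ_v _ _ rfl _ _ _ _ (p₀ + 1 + m) (p₀ + 1 + 1) (by lia) rfl,
      δ_v _ _ rfl _ _ _ _ (p₀ + 1 + m) (p₀ + 1 + 1) (by lia) rfl,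
      Cochain.single_v_eq_zero _ _ _ _ _ (by lia)]
    simp [hβ, u, smul_smul]

open Cochain.InductionUp in
lemma isKPI_of_isBoundedBelow {L : Cplx R} (hb : IsBoundedBelow L) (hL : ∀ i, IsPI (L.X i)) :
    IsKPI L := by
  intro K hK m n k hmn hnk z hz
  obtain ⟨d, hd⟩ := hb
  -- For `i = 0` the comparison only involves components landing in degrees below `d`, where `L`
  -- vanishes; hence the zero cochain is a valid start.
  let X (i : ℕ) : Set (Cochain K L m) := {α | (δ m n α).EqUpTo z (i + d - n - 1)}
  let x₀ : X 0 := ⟨0, fun p q hpq hp ↦ (hd _ (by lia)).eq_of_tgt _ _⟩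
  let φ (i : ℕ) (α : X i) : X (i + 1) :=
    ⟨_, (exists_single_eqUpTo hK hL hmn hnk z hz α.1 (i + d - n - 1) ((i + 1 : ℕ) + d - n - 1)
      (by lia) α.2).choose_spec⟩
  have hφ (i : ℕ) (x : X i) : (φ i x).1.EqUpTo x.1 (d - n + i) := fun p q hpq hp ↦ by
    dsimp [φ]
    rw [add_eq_left, Cochain.single_v_eq_zero _ _ _ _ _ (by lia)]
  refine ⟨limitSequence φ hφ x₀, Cochain.ext _ _ fun p q hpq ↦ ?_⟩
  let k₀ := (p - d + n + 1).toNat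
  rw [← (sequence φ x₀ k₀).2 p q hpq (by lia),
    δ_v _ _ hmn _ p q hpq (q - 1) (p + 1) rfl rfl,
    δ_v _ _ hmn _ p q hpq (q - 1) (p + 1) rfl rfl,
    limitSequence_eqUpTo φ hφ x₀ k₀ p (q - 1) (by lia) (by lia),
    limitSequence_eqUpTo φ hφ x₀ k₀ (p + 1) q (by lia) (by lia)]

lemma IsPI.isPureInjective {E : ModuleCat.{u} R} (hE : IsPI E) : IsPureInjective E := by
  refine IsKPI.isKPureInjective (isKPI_of_isBoundedBelow ⟨0, fun i hi ↦ ?_⟩ fun i ↦ ?_)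
  · exact HomologicalComplex.isZero_single_obj_X _ _ _ _ (by lia)
  · by_cases hi : i = 0
    · subst hi
      let e : ((CochainComplex.singleFunctor (ModuleCat.{u} R) 0).obj E).X 0 ≅ E :=
        HomologicalComplex.singleObjXSelf (ComplexShape.up ℤ) 0 E
      exact hE.of_retract e.hom e.inv e.hom_inv_id
    · exact .of_isZero (HomologicalComplex.isZero_single_obj_X _ _ _ _ hi)

end Complexes
end PureRes

namespace PureRes

open TensorProduct CochainComplex CochainComplex.HomComplex

/-! ### Character modules: pure injectivity and pure embeddings. -/

section Character

variable {R : Type u} [CommRing R]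

/-- The character descends to the range of `f`, and then extends to `C` because `ℚ/ℤ` is divisible.
-/
lemma exists_character_comp_eq {B C : Type u} [AddCommGroup B] [AddCommGroup C] (f : B →+ C)
    (χ : CharacterModule B) (h : ∀ b, f b = 0 → χ b = 0) :
    ∃ ψ : CharacterModule C, ∀ b, ψ (f b) = χ b := by
  let χ' : CharacterModule f.range := f.rangeRestrict.liftOfSurjective f.rangeRestrict_surjective
    ⟨χ, fun b hb ↦ h b (congr_arg Subtype.val hb)⟩
  obtain ⟨ψ, hψ⟩ := CharacterModule.dual_surjective_of_injective (R := ℤ)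
    f.range.subtype.toIntLinearMap f.range.subtype_injective χ'
  refine ⟨ψ, fun b ↦ (DFunLike.congr_fun hψ (f.rangeRestrict b)).trans ?_⟩
  exact AddMonoidHom.liftOfRightInverse_comp_apply f.rangeRestrict _ _
    ⟨(χ : B →+ _), fun b hb ↦ h b (congr_arg Subtype.val hb)⟩ b

/-- By adjunction, maps from `A` to the character module of `X` are characters of `X ⊗ A`; this
complex is exact, and taking characters preserves exactness. -/
lemma isPI_characterModule (X : Type u) [AddCommGroup X] [Module R X] :
    IsPI (ModuleCat.of R (CharacterModule X)) := by
  intro A hA i j k hij hjk φ hφ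
  rw [isPureAcyclic_iff_forall] at hA
  let χ : CharacterModule (X ⊗[R] A.X j) := CharacterModule.homEquiv (R := R) φ.hom |>.comp
    (TensorProduct.comm R X (A.X j)).toAddMonoidHom
  have hχ (x : X) (a : A.X j) : χ (x ⊗ₜ a) = φ.hom a x := rfl
  obtain ⟨ψ, hψ⟩ := exists_character_comp_eq ((A.d j k).hom.lTensor X).toAddMonoidHom χ (by
    intro b hb
    obtain ⟨y, rfl⟩ := hA (ModuleCat.of R X) i j k hij hjk b hb
    clear hb
    induction y with
    | zero => simp
    | add y y' h h' => rw [map_add, map_add, h, h', add_zero]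
    | tmul x a => exact DFunLike.congr_fun (ConcreteCategory.congr_hom hφ a) x)
  refine ⟨ModuleCat.ofHom (CharacterModule.curry (R := R)
    (ψ.comp (TensorProduct.comm R (A.X k) X).toAddMonoidHom)), ?_⟩
  refine ModuleCat.hom_ext (LinearMap.ext fun a ↦ CharacterModule.ext _ fun x ↦ ?_)
  exact hψ (x ⊗ₜ a)

/-- A pure submodule has the lifting property of its quotient against finitely presented modules. -/
lemma exists_lift_of_lTensor_injective {A B C P : Type u} [AddCommGroup A] [AddCommGroup B]
    [AddCommGroup C] [AddCommGroup P] [Module R A] [Module R B] [Module R C] [Module R P]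
    [Module.FinitePresentation R P] (f : A →ₗ[R] B) (g : B →ₗ[R] C)
    (hf : ∀ (N : Type u) [AddCommGroup N] [Module R N], Function.Injective (f.lTensor N))
    (hg : Function.Surjective g) (hfg : ∀ b, g b = 0 ↔ ∃ a, f a = b) (x : P →ₗ[R] C) :
    ∃ y : P →ₗ[R] B, g ∘ₗ y = x := by
  obtain ⟨k, K, ε, hK⟩ := Module.FinitePresentation.exists_fin R P
  let π : (Fin k → R) →ₗ[R] P := ε.symm ∘ₗ K.mkQ
  have hπ : Function.Surjective π := ε.symm.surjective.comp K.mkQ_surjective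
  have hker : (LinearMap.ker π).FG := by
    rwa [LinearMap.ker_comp_of_ker_eq_bot _ ε.symm.ker, K.ker_mkQ]
  obtain ⟨r, a, ha⟩ := Submodule.fg_iff_exists_fin_generating_family.1 hker
  have he (v : Fin k → R) : v = ∑ j, v j • (Pi.single j 1 : Fin k → R) := by
    simp [← pi_eq_sum_univ']
  choose b hb using fun j ↦ hg (x (π (Pi.single j 1)))
  have hab (i) : g (∑ j, a i j • b j) = 0 := by
    have : π (a i) = 0 := LinearMap.mem_ker.1 (ha ▸ Submodule.subset_span ⟨i, rfl⟩)
    rw [he (a i)] at this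
    simpa [hb] using congr_arg x this
  choose α hα using fun i ↦ (hfg _).1 (hab i)
  -- The aim is to solve `∑ⱼ aᵢⱼ wⱼ = αᵢ` in `A`, so that `b - f w` satisfies the relations of `P`.
  -- Solvability amounts to the vanishing of `∑ eᵢ ⊗ αᵢ` over the quotient of `R^r` by the columns
  -- of `a`. It vanishes after applying `f`, as `b` is a solution in `B`, hence already in `A` by
  -- purity.
  let S : Submodule R (Fin r → R) := Submodule.span R (Set.range fun j i ↦ a i j)
  let e (i : Fin r) : (Fin r → R) ⧸ S := S.mkQ (Pi.single i 1)
  have hsum (c : Fin r → R) : ∑ i, c i • e i = S.mkQ c := by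
    conv_rhs => rw [show c = ∑ i, c i • (Pi.single i 1 : Fin r → R) by simp [← pi_eq_sum_univ']]
    simp only [map_sum, map_smul, e]
  have hspan : Submodule.span R (Set.range e) = ⊤ := by
    refine eq_top_iff.2 fun q _ ↦ ?_
    obtain ⟨c, rfl⟩ := S.mkQ_surjective q
    exact (Submodule.mem_span_range_iff_exists_fun R).2 ⟨c, hsum c⟩
  have hzero : ∑ i, e i ⊗ₜ[R] α i = 0 := by
    apply hf
    simp only [map_sum, LinearMap.lTensor_tmul, hα, map_zero, tmul_sum]
    rw [Finset.sum_comm]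
    refine Finset.sum_eq_zero fun j _ ↦ ?_
    simp only [← smul_tmul, ← sum_tmul, hsum fun i ↦ a i j]
    rw [show S.mkQ (fun i ↦ a i j) = 0 from
      (Submodule.Quotient.mk_eq_zero S).2 (Submodule.subset_span ⟨j, rfl⟩), zero_tmul]
  obtain ⟨s, c, y, hy, hc⟩ := TensorProduct.vanishesTrivially_of_sum_tmul_eq_zero R hspan hzero
  have hcS (l) : ∃ t : Fin k → R, ∑ j, t j • (fun i ↦ a i j) = fun i ↦ c i l := by
    refine (Submodule.mem_span_range_iff_exists_fun R).1 ?_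
    exact (Submodule.Quotient.mk_eq_zero S).1 ((hsum fun i ↦ c i l).symm.trans (hc l))
  choose t ht using hcS
  let β (j : Fin k) : B := b j - f (∑ l, t l j • y l)
  have hβ (i) : ∑ j, a i j • β j = 0 := by
    have : ∑ j, a i j • ∑ l, t l j • y l = α i := by
      rw [hy]
      simp only [Finset.smul_sum]
      rw [Finset.sum_comm]
      refine Finset.sum_congr rfl fun l _ ↦ ?_
      have := congr_fun (ht l) i
      simp only [Finset.sum_apply, Pi.smul_apply, smul_eq_mul] at this
      rw [← this, Finset.sum_smul]
      exact Finset.sum_congr rfl fun j _ ↦ by rw [smul_smul, mul_comm]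
    simp only [β, smul_sub, Finset.sum_sub_distrib, ← hα, ← map_smul, ← map_sum, this, sub_self]
  have hle : LinearMap.ker π ≤ LinearMap.ker (Fintype.linearCombination R β) := by
    rw [← ha, Submodule.span_le]
    rintro _ ⟨i, rfl⟩
    simpa [Fintype.linearCombination_apply] using hβ i
  refine ⟨(LinearMap.ker π).liftQ _ hle ∘ₗ (π.quotKerEquivOfSurjective hπ).symm, ?_⟩
  rw [← LinearMap.cancel_right hπ]
  ext j
  have h1 : (π.quotKerEquivOfSurjective hπ).symm (π (Pi.single j 1)) =
      (LinearMap.ker π).mkQ (Pi.single j 1) := by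
    rw [LinearEquiv.symm_apply_eq]; rfl
  have h2 : ∑ l, t l j • g (f (y l)) = 0 := by
    simp [fun a ↦ (hfg (f a)).2 ⟨a, rfl⟩]
  simp only [LinearMap.comp_apply, LinearMap.single_apply, LinearEquiv.coe_coe, h1]
  simp [Fintype.linearCombination_apply, Pi.single_apply, β, h2, hb]

/-- The evaluation map of a module into its double character module. -/
def characterEval (M : Type u) [AddCommGroup M] [Module R M] :
    M →ₗ[R] CharacterModule (CharacterModule M) where
  toFun m := AddMonoidHom.mk' (fun c ↦ c m) fun _ _ ↦ rfl
  map_add' m m' := CharacterModule.ext _ fun c ↦ map_add c m m'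
  map_smul' _ _ := rfl

/-- Each character of `N ⊗ M` extends along the map: curry it to `N ⟶ M*`, evaluate into `M***`, and
uncurry. An element of the kernel is thus killed by all characters. -/
lemma lTensor_characterEval_injective (M N : Type u) [AddCommGroup M] [Module R M]
    [AddCommGroup N] [Module R N] :
    Function.Injective ((characterEval (R := R) M).lTensor N) := by
  rw [injective_iff_map_eq_zero]
  intro z hz
  refine CharacterModule.eq_zero_of_character_apply fun χ ↦ ?_
  let χ' : CharacterModule (N ⊗[R] CharacterModule (CharacterModule M)) :=
    CharacterModule.uncurry (R := R)
      (characterEval (CharacterModule M) ∘ₗ CharacterModule.curry (R := R) χ)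
  have : ∀ t, χ' ((characterEval M).lTensor N t) = χ t := fun t ↦ by
    induction t with
    | zero => simp
    | add t t' h h' => rw [map_add, map_add, h, h', map_add]
    | tmul n m => rfl
  rw [← this, hz, map_zero]

lemma characterEval_injective (M : Type u) [AddCommGroup M] [Module R M] :
    Function.Injective (characterEval (R := R) M) := by
  rw [injective_iff_map_eq_zero]
  exact fun m hm ↦ CharacterModule.eq_zero_of_character_apply fun c ↦ DFunLike.congr_fun hm c

variable (R) in
/-- The functor sending a module to its double character module. -/
def doubleCharacter : ModuleCat.{u} R ⥤ ModuleCat.{u} R where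
  obj M := ModuleCat.of R (CharacterModule (CharacterModule M))
  map f := ModuleCat.ofHom (CharacterModule.dual (CharacterModule.dual f.hom))

instance : (doubleCharacter R).Additive where
  map_add {M N f g} := by
    refine ModuleCat.hom_ext (LinearMap.ext fun (c : CharacterModule (CharacterModule M)) ↦
      CharacterModule.ext _ fun d ↦ ?_)
    refine Eq.trans ?_ (map_add c _ _)
    exact congr_arg c (CharacterModule.ext _ fun m ↦ map_add d _ _)

variable (R) in
/-- The evaluation map into the double character module, as a natural transformation. -/
def toDoubleCharacter : 𝟭 (ModuleCat.{u} R) ⟶ doubleCharacter R where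
  app M := ModuleCat.ofHom (characterEval M)

lemma isPI_doubleCharacter (M : ModuleCat.{u} R) : IsPI ((doubleCharacter R).obj M) :=
  isPI_characterModule _

instance (M : ModuleCat.{u} R) : Mono ((toDoubleCharacter R).app M) :=
  (ModuleCat.mono_iff_injective _).2 (characterEval_injective M)

lemma exists_lift_of_toDoubleCharacter {M C P : ModuleCat.{u} R} [Module.FinitePresentation R P]
    (g : (doubleCharacter R).obj M ⟶ C) (w : (toDoubleCharacter R).app M ≫ g = 0)
    (hg : (ShortComplex.mk _ g w).Exact) (hg' : Epi g) (x : P ⟶ C) : ∃ y, y ≫ g = x := by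
  obtain ⟨y, hy⟩ := exists_lift_of_lTensor_injective (characterEval (R := R) M) g.hom
    (fun N _ _ ↦ lTensor_characterEval_injective M N) ((ModuleCat.epi_iff_surjective g).1 hg')
    (fun b ↦ ⟨(ShortComplex.moduleCat_exact_iff _).1 hg b, fun ⟨a, ha⟩ ↦
      ha ▸ ConcreteCategory.congr_hom w a⟩) x.hom
  exact ⟨ModuleCat.ofHom y, ModuleCat.hom_ext hy⟩

end Character
end PureRes

namespace PureRes

open CochainComplex CochainComplex.HomComplex

/-! ### Pure cosyzygies and the lifting problem for their totalization. -/

section BoundedBelow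

variable {R : Type u} [CommRing R]

lemma v_comp_d_of_δ_eq_zero {A B : Cplx R} (z : Cochain A B 1) (hz : δ 1 2 z = 0) (p q r : ℤ)
    (hpq : p + 1 = q) (hqr : q + 1 = r) :
    z.v p q hpq ≫ B.d q r = -(A.d p q ≫ z.v q r hqr) := by
  have := Cochain.congr_v hz p r (by lia)
  rw [δ_v 1 2 rfl z p r (by lia) q q (by lia) (by lia)] at this
  simpa [add_eq_zero_iff_eq_neg, Int.negOnePow_even 2 (by decide)] using this

/-- All terms of `F` of degree less than `a` vanish. -/
def VanishesBelow (F : Cplx R) (a : ℤ) : Prop := ∀ i < a, IsZero (F.X i)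

lemma VanishesBelow.mono {F : Cplx R} {a b : ℤ} (h : VanishesBelow F b) (hab : a ≤ b) :
    VanishesBelow F a :=
  fun i hi ↦ h i (hi.trans_le hab)

/-- A termwise pure embedding `η` of `F` into a complex of pure injective modules, together
with its cokernel, shifted so that the projection to it becomes a cocycle `π` of degree `1`. -/
structure Cosyzygy (F Q : Cplx R) where
  /-- the complex of pure injective modules in which `F` embeds -/
  E : Cplx R
  /-- the pure embedding -/
  η : F ⟶ E
  /-- the projection -/
  π : Cochain E Q 1
  isPI : ∀ i, IsPI (E.X i)
  isZero : ∀ i, IsZero (F.X i) → IsZero (E.X i)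
  δ_π : δ 1 2 π = 0
  mono : ∀ p, Mono (η.f p)
  epi : ∀ p q h, Epi (π.v p q h)
  η_π : ∀ p q h, η.f p ≫ π.v p q h = 0
  exact : ∀ p q h, (ShortComplex.mk _ _ (η_π p q h)).Exact
  lift : ∀ p q h (P : ModuleCat.{u} R) [Module.FinitePresentation R P] (x : P ⟶ Q.X q),
    ∃ y, y ≫ π.v p q h = x

attribute [instance] Cosyzygy.mono Cosyzygy.epi

lemma Cosyzygy.vanishesBelow {F Q : Cplx R} (S : Cosyzygy F Q) {a : ℤ} (h : VanishesBelow F a) :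
    VanishesBelow Q (a + 1) :=
  fun i hi ↦ IsZero.of_epi (S.π.v (i - 1) i (by lia)) (S.isZero _ (h _ (by lia)))

/-- The complex obtained by taking termwise double character modules. -/
noncomputable abbrev envelope (F : Cplx R) : Cplx R :=
  ((doubleCharacter R).mapHomologicalComplex (ComplexShape.up ℤ)).obj F

/-- The termwise evaluation map from a complex to its termwise double character complex. -/
noncomputable def toEnvelope (F : Cplx R) : F ⟶ envelope F where
  f i := (toDoubleCharacter R).app (F.X i)
  comm' i j _ := ((toDoubleCharacter R).naturality (F.d i j)).symm

/-- The cocycle of degree `1` from `envelope F` to the shifted cokernel of `F ⟶ envelope F`. -/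
noncomputable def envelopeπ (F : Cplx R) :
    Cochain (envelope F) ((cokernel (toEnvelope F))⟦(-1 : ℤ)⟧) 1 :=
  (Cochain.ofHom (cokernel.π (toEnvelope F))).rightShift (-1) 1 (by simp)

lemma envelopeπ_v (F : Cplx R) (p q : ℤ) (h : p + 1 = q) : (envelopeπ F).v p q h =
    (cokernel.π (toEnvelope F)).f p ≫
      ((cokernel (toEnvelope F)).shiftFunctorObjXIso (-1) q p (by lia)).inv := by
  rw [envelopeπ, Cochain.rightShift_v _ _ _ _ p q h p (by lia), Cochain.ofHom_v]

lemma toEnvelope_envelopeπ_v (F : Cplx R) (p q : ℤ) (h : p + 1 = q) :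
    (toEnvelope F).f p ≫ (envelopeπ F).v p q h = 0 := by
  rw [envelopeπ_v, ← Category.assoc, ← HomologicalComplex.comp_f, cokernel.condition,
    HomologicalComplex.zero_f, zero_comp]

lemma epi_envelopeπ_v (F : Cplx R) (p q : ℤ) (h : p + 1 = q) :
    Epi ((envelopeπ F).v p q h) := by
  rw [envelopeπ_v]
  exact epi_comp _ _

lemma exact_envelopeπ_v (F : Cplx R) (p q : ℤ) (h : p + 1 = q) :
    (ShortComplex.mk _ _ (toEnvelope_envelopeπ_v F p q h)).Exact := by
  have h₁ := (ShortComplex.exact_cokernel (toEnvelope F)).map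
    (HomologicalComplex.eval (ModuleCat.{u} R) (ComplexShape.up ℤ) p)
  let S₁ := (ShortComplex.mk _ _ (cokernel.condition (toEnvelope F))).map
    (HomologicalComplex.eval (ModuleCat.{u} R) (ComplexShape.up ℤ) p)
  let e : S₁ ≅ ShortComplex.mk _ _ (toEnvelope_envelopeπ_v F p q h) :=
    ShortComplex.isoMk (Iso.refl (F.X p)) (Iso.refl ((envelope F).X p))
      (((cokernel (toEnvelope F)).shiftFunctorObjXIso (-1) q p (by lia)).symm)
      ((Category.id_comp _).trans (Category.comp_id _).symm)
      ((Category.id_comp _).trans (envelopeπ_v F p q h))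
  exact (ShortComplex.exact_iff_of_iso e).1 h₁

/-- The cosyzygy given by double character modules. -/
noncomputable def cosyzygy (F : Cplx R) : Cosyzygy F ((cokernel (toEnvelope F))⟦(-1 : ℤ)⟧) where
  E := envelope F
  η := toEnvelope F
  π := envelopeπ F
  isPI i := isPI_doubleCharacter (F.X i)
  isZero i hi := (doubleCharacter R).map_isZero hi
  δ_π := by
    rw [envelopeπ, Cochain.δ_rightShift _ (-1) 1 2 _ 1 (by lia)]
    simp
  mono p := inferInstanceAs (Mono ((toDoubleCharacter R).app (F.X p)))
  epi := epi_envelopeπ_v F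
  η_π := toEnvelope_envelopeπ_v F
  exact := exact_envelopeπ_v F
  lift p q h P _ x := exists_lift_of_toDoubleCharacter _ (toEnvelope_envelopeπ_v F p q h)
      (exact_envelopeπ_v F p q h) (epi_envelopeπ_v F p q h) x

/-- This is the lifting property of the augmentation into the total complex, in components. The
induction on `t` drops the first cosyzygy; it ends because, for `j < a`, every `E` vanishes in
degree `j`. -/
lemma exists_lift_cosyzygies {P : ModuleCat.{u} R} [Module.FinitePresentation R P] {i j k l : ℤ}
    (hij : i + 1 = j) (hjk : j + 1 = k) (hkl : k + 1 = l) (t : ℕ) (Q : ℕ → Cplx R)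
    (S : ∀ n, Cosyzygy (Q n) (Q (n + 1))) (a : ℤ) (hQ : ∀ n, VanishesBelow (Q n) (a + n))
    (hj : j < a + t) (x : P ⟶ (Q 0).X k) (y : ∀ n, P ⟶ (S n).E.X j)
    (hx : x ≫ (Q 0).d k l = 0) (hxy : x ≫ (S 0).η.f k + y 0 ≫ (S 0).E.d j k = 0)
    (hy : ∀ n, y (n + 1) ≫ (S (n + 1)).E.d j k +
      y n ≫ (S n).π.v j k hjk ≫ (S (n + 1)).η.f k = 0) :
    ∃ (x' : P ⟶ (Q 0).X j) (w : ∀ n, P ⟶ (S n).E.X i), x' ≫ (Q 0).d j k = -x ∧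
      x' ≫ (S 0).η.f j + w 0 ≫ (S 0).E.d i j = y 0 ∧
      ∀ n, w (n + 1) ≫ (S (n + 1)).E.d i j +
        w n ≫ (S n).π.v i j hij ≫ (S (n + 1)).η.f j = y (n + 1) := by
  induction t generalizing Q a with
  | zero =>
    have h0 (n) : IsZero ((S n).E.X j) := (S n).isZero j (hQ n j (by lia))
    refine ⟨0, 0, ?_, (h0 0).eq_of_tgt _ _, fun n ↦ (h0 _).eq_of_tgt _ _⟩
    rw [(h0 0).eq_of_tgt (y 0) 0, zero_comp, add_zero] at hxy
    rw [zero_comp, eq_comm, neg_eq_zero, ← cancel_mono ((S 0).η.f k), hxy, zero_comp]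
  | succ t ih =>
    obtain ⟨x', w, h₁, h₂, h₃⟩ := ih (fun n ↦ Q (n + 1)) (fun n ↦ S (n + 1)) (a + 1)
      (fun n ↦ (hQ (n + 1)).mono (by push_cast; lia)) (by push_cast at hj; lia)
      (y 0 ≫ (S 0).π.v j k hjk) (fun n ↦ y (n + 1))
      (by
        rw [Category.assoc, v_comp_d_of_δ_eq_zero _ (S 0).δ_π j k l hjk hkl,
          Preadditive.comp_neg, neg_eq_zero, ← Category.assoc,
          ← neg_eq_of_add_eq_zero_right hxy, Preadditive.neg_comp, Category.assoc,
          (S 0).η_π, comp_zero, neg_zero])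
      (by simpa [add_comm] using hy 0)
      (fun n ↦ hy (n + 1))
    -- The solution for the tail provides `x'` in the first cosyzygy. It lifts to `w₀` by purity,
    -- and `y 0` minus the differential of `w₀` is then killed by `π`, so it comes from `Q 0`.
    obtain ⟨w₀, hw₀⟩ := (S 0).lift i j hij P x'
    have hlift : (y 0 - w₀ ≫ (S 0).E.d i j) ≫ (S 0).π.v j k hjk = 0 := by
      have := v_comp_d_of_δ_eq_zero _ (S 0).δ_π i j k hij hjk
      rw [Preadditive.sub_comp, Category.assoc, ← neg_eq_iff_eq_neg.2 this, Preadditive.comp_neg,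
        ← Category.assoc w₀, hw₀, h₁]
      simp
    obtain ⟨x'', hx''⟩ : ∃ x'' : P ⟶ (Q 0).X j, x'' ≫ (S 0).η.f j = y 0 - w₀ ≫ (S 0).E.d i j :=
      ⟨((S 0).exact j k hjk).lift _ hlift, ((S 0).exact j k hjk).lift_f _ hlift⟩
    refine ⟨x'', fun n ↦ Nat.casesOn n w₀ w, ?_, ?_, fun n ↦ ?_⟩
    · rw [← cancel_mono ((S 0).η.f k), Category.assoc, ← (S 0).η.comm,
        ← Category.assoc, hx'', Preadditive.neg_comp, neg_eq_of_add_eq_zero_right hxy]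
      simp
    · rw [hx'']
      exact sub_add_cancel _ _
    · cases n with
      | zero =>
        change w 0 ≫ _ + w₀ ≫ _ = _
        rw [← Category.assoc w₀, hw₀]
        exact (add_comm _ _).trans h₂
      | succ n => exact h₃ n

end BoundedBelow
end PureRes

namespace PureRes

open CochainComplex CochainComplex.HomComplex

/-! ### Total complexes and resolutions of bounded below complexes. -/

section Resolution

variable {R : Type u} [CommRing R]

lemma isPI_pi {ι : Type} (E : ι → ModuleCat.{u} R) (hE : ∀ i, IsPI (E i)) : IsPI (∏ᶜ E) := by
  intro A hA a b c hab hbc φ hφ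
  choose ψ hψ using fun i ↦ hE i A hA a b c hab hbc (φ ≫ Pi.π E i) (by
    rw [← Category.assoc, hφ, zero_comp])
  exact ⟨Pi.lift ψ, Pi.hom_ext _ _ fun i ↦ by simp [hψ]⟩

lemma IsZero.pi {ι : Type} (E : ι → ModuleCat.{u} R) (hE : ∀ i, IsZero (E i)) : IsZero (∏ᶜ E) := by
  rw [IsZero.iff_id_eq_zero]
  exact Pi.hom_ext _ _ fun i ↦ (hE i).eq_of_tgt _ _

section

variable {Q : ℕ → Cplx R} (S : ∀ n, Cosyzygy (Q n) (Q (n + 1)))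

/-- The components of the differential of the total complex of a sequence of cosyzygies. -/
noncomputable def totalDComponent (p q : ℤ) (h : p + 1 = q) :
    ∀ n : ℕ, (∏ᶜ fun n ↦ (S n).E.X p) ⟶ (S n).E.X q
  | 0 => Pi.π (fun n ↦ (S n).E.X p) 0 ≫ (S 0).E.d p q
  | n + 1 => Pi.π (fun n ↦ (S n).E.X p) (n + 1) ≫ (S (n + 1)).E.d p q +
      Pi.π (fun n ↦ (S n).E.X p) n ≫ (S n).π.v p q h ≫ (S (n + 1)).η.f q

/-- The differential of the total complex of a sequence of cosyzygies. -/
noncomputable def totalD (p q : ℤ) :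
    (∏ᶜ fun n ↦ (S n).E.X p) ⟶ ∏ᶜ fun n ↦ (S n).E.X q :=
  if h : p + 1 = q then Pi.lift (totalDComponent S p q h) else 0

lemma totalD_π_zero (p q : ℤ) (h : p + 1 = q) :
    totalD S p q ≫ Pi.π (fun n ↦ (S n).E.X q) 0 =
      Pi.π (fun n ↦ (S n).E.X p) 0 ≫ (S 0).E.d p q := by
  simp [totalD, h, totalDComponent]

lemma totalD_π_succ (p q : ℤ) (h : p + 1 = q) (n : ℕ) :
    totalD S p q ≫ Pi.π (fun n ↦ (S n).E.X q) (n + 1) =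
      Pi.π (fun n ↦ (S n).E.X p) (n + 1) ≫ (S (n + 1)).E.d p q +
        Pi.π (fun n ↦ (S n).E.X p) n ≫ (S n).π.v p q h ≫ (S (n + 1)).η.f q := by
  simp [totalD, h, totalDComponent]

lemma totalD_π_comp (p q r : ℤ) (hpq : p + 1 = q) (hqr : q + 1 = r) (n : ℕ) :
    totalD S p q ≫ Pi.π (fun n ↦ (S n).E.X q) n ≫ (S n).π.v q r hqr =
      Pi.π (fun n ↦ (S n).E.X p) n ≫ (S n).E.d p q ≫ (S n).π.v q r hqr := by
  cases n with
  | zero => rw [← Category.assoc, totalD_π_zero _ _ _ hpq, Category.assoc]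
  | succ n => simp [← Category.assoc (totalD S p q), totalD_π_succ _ _ _ hpq, (S (n + 1)).η_π]

/-- The mixed terms cancel since `π`, a cocycle of degree `1`, anticommutes with differentials while
`η` commutes with them; the term moving two steps contains `η` followed by `π`, which is zero. -/
lemma totalD_comp (p q r : ℤ) (hpq : p + 1 = q) (hqr : q + 1 = r) :
    totalD S p q ≫ totalD S q r = 0 := by
  refine Pi.hom_ext _ _ fun n ↦ ?_
  cases n with
  | zero =>
    rw [Category.assoc, totalD_π_zero _ _ _ hqr, ← Category.assoc, totalD_π_zero _ _ _ hpq]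
    simp
  | succ n =>
    have h := v_comp_d_of_δ_eq_zero _ (S n).δ_π p q r hpq hqr
    rw [Category.assoc, totalD_π_succ _ _ _ hqr, Preadditive.comp_add, ← Category.assoc,
      totalD_π_succ _ _ _ hpq]
    simp only [Preadditive.add_comp, Category.assoc, HomologicalComplex.d_comp_d, comp_zero,
      zero_add, zero_comp, (S (n + 1)).η.comm]
    rw [← Category.assoc ((S n).π.v p q hpq), h]
    have h' := totalD_π_comp S p q r hpq hqr n =≫ (S (n + 1)).η.f r
    simp only [Category.assoc] at h'
    simp [h']

/-- The total complex of a sequence of cosyzygies. -/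
noncomputable def total : Cplx R where
  X p := ∏ᶜ fun n ↦ (S n).E.X p
  d := totalD S
  shape _ _ h := dif_neg h
  d_comp_d' p q r := totalD_comp S p q r

/-- The projections from the terms of the total complex. -/
noncomputable def totalπ (p : ℤ) (n : ℕ) : (total S).X p ⟶ (S n).E.X p :=
  Pi.π (fun n ↦ (S n).E.X p) n

/-- Morphisms to the terms of the total complex. -/
noncomputable def totalLift {P : ModuleCat.{u} R} {p : ℤ} (w : ∀ n, P ⟶ (S n).E.X p) :
    P ⟶ (total S).X p :=
  Pi.lift w

variable {S} in
lemma total_hom_ext {P : ModuleCat.{u} R} {p : ℤ} {x y : P ⟶ (total S).X p}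
    (h : ∀ n, x ≫ totalπ S p n = y ≫ totalπ S p n) : x = y :=
  Pi.hom_ext _ _ h

@[simp]
lemma totalLift_π {P : ModuleCat.{u} R} {p : ℤ} (w : ∀ n, P ⟶ (S n).E.X p) (n : ℕ) :
    totalLift S w ≫ totalπ S p n = w n :=
  Pi.lift_π w n

@[simp]
lemma totalLift_π_assoc {P P' : ModuleCat.{u} R} {p : ℤ} (w : ∀ n, P ⟶ (S n).E.X p) (n : ℕ)
    (h : (S n).E.X p ⟶ P') : totalLift S w ≫ totalπ S p n ≫ h = w n ≫ h := by
  rw [← Category.assoc, totalLift_π]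

lemma total_d_π_zero {p q : ℤ} (h : p + 1 = q) :
    (total S).d p q ≫ totalπ S q 0 = totalπ S p 0 ≫ (S 0).E.d p q :=
  totalD_π_zero S p q h

lemma total_d_π_succ {p q : ℤ} (h : p + 1 = q) (n : ℕ) :
    (total S).d p q ≫ totalπ S q (n + 1) = totalπ S p (n + 1) ≫ (S (n + 1)).E.d p q +
        totalπ S p n ≫ (S n).π.v p q h ≫ (S (n + 1)).η.f q :=
  totalD_π_succ S p q h n

/-- The components of the augmentation to the total complex of a sequence of cosyzygies. -/
noncomputable def toTotalComponent (p : ℤ) : ∀ n : ℕ, (Q 0).X p ⟶ (S n).E.X p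
  | 0 => (S 0).η.f p
  | _ + 1 => 0

/-- The augmentation to the total complex of a sequence of cosyzygies. -/
noncomputable def toTotal : Q 0 ⟶ total S where
  f p := totalLift S (toTotalComponent S p)
  comm' p q h := by
    refine total_hom_ext fun n ↦ ?_
    rw [Category.assoc, Category.assoc, totalLift_π]
    match n with
    | 0 =>
      rw [total_d_π_zero _ h]
      simp [toTotalComponent]
    | 1 =>
      rw [total_d_π_succ _ h 0]
      have h₀ := (S 0).η_π p q h =≫ (S 1).η.f q
      simpa [toTotalComponent] using h₀
    | n + 2 =>
      rw [total_d_π_succ _ h]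
      simp [toTotalComponent]

lemma toTotal_f_π_zero (p : ℤ) : (toTotal S).f p ≫ totalπ S p 0 = (S 0).η.f p :=
  totalLift_π S _ _

lemma toTotal_f_π_succ (p : ℤ) (n : ℕ) : (toTotal S).f p ≫ totalπ S p (n + 1) = 0 :=
  totalLift_π S _ _

lemma isHomQuasiIso_toTotal (a : ℤ) (hQ : ∀ n : ℕ, VanishesBelow (Q n) (a + n)) :
    IsHomQuasiIso (toTotal S) := by
  intro P _ i j k l hij hjk hkl x y hx hxy
  obtain ⟨x', w, h₁, h₂, h₃⟩ := exists_lift_cosyzygies hij hjk hkl (j - a + 1).toNat Q S a hQ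
    (by lia) x (fun n ↦ y ≫ totalπ S j n) hx
    (by simpa [toTotal_f_π_zero, total_d_π_zero S hjk] using hxy =≫ totalπ S k 0)
    (fun n ↦ by
      simpa [toTotal_f_π_succ, total_d_π_succ S hjk] using hxy =≫ totalπ S k (n + 1))
  refine ⟨x', totalLift S w, h₁, total_hom_ext fun n ↦ ?_⟩
  cases n with
  | zero => simpa [toTotal_f_π_zero, total_d_π_zero S hij] using h₂
  | succ n => simpa [toTotal_f_π_succ, total_d_π_succ S hij] using h₃ n

end

/-- Every bounded below complex has a bounded below pure injective resolution. -/
lemma exists_resolution {F : Cplx R} (hF : IsBoundedBelow F) : ∃ (K : Cplx R) (ρ : F ⟶ K),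
    IsBoundedBelow K ∧ (∀ i, IsPI (K.X i)) ∧ IsHomQuasiIso ρ := by
  obtain ⟨a, ha⟩ := hF
  -- The shift by `-1` raises the lower bound by one at each stage, so only finitely many stages
  -- contribute in a given degree.
  let Q (n : ℕ) : Cplx R := Nat.rec F (fun _ X ↦ (cokernel (toEnvelope X))⟦(-1 : ℤ)⟧) n
  let S (n : ℕ) : Cosyzygy (Q n) (Q (n + 1)) := cosyzygy (Q n)
  have hQ (n : ℕ) : VanishesBelow (Q n) (a + n) := by
    induction n with
    | zero => exact VanishesBelow.mono ha (by simp)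
    | succ n ih => exact ((S n).vanishesBelow ih).mono (by push_cast; lia)
  exact ⟨total S, toTotal S, ⟨a, fun i hi ↦ IsZero.pi _ fun n ↦ (S n).isZero i (hQ n i (by lia))⟩,
    fun i ↦ isPI_pi _ fun n ↦ (S n).isPI i, isHomQuasiIso_toTotal S a hQ⟩

end Resolution

/-! ### Degreewise split extensions defined by a twisted differential. -/

section Twist

variable {R : Type u} [CommRing R]

/-- The extension of `I` by `K` given by a family `θ` of morphisms of degree `1`
anticommuting with the differentials. -/
noncomputable def twist (K I : Cplx R) (θ : ∀ p q : ℤ, p + 1 = q → (I.X p ⟶ K.X q))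
    (hθ : ∀ p q r hpq hqr, θ p q hpq ≫ K.d q r = -(I.d p q ≫ θ q r hqr)) : Cplx R where
  X p := K.X p ⊞ I.X p
  d p q := if h : p + 1 = q then
    biprod.lift (biprod.fst ≫ K.d p q + biprod.snd ≫ θ p q h) (biprod.snd ≫ I.d p q) else 0
  shape p q h := dif_neg h
  d_comp_d' p q r (hpq : p + 1 = q) (hqr : q + 1 = r) := by
    rw [dif_pos hpq, dif_pos hqr]
    apply biprod.hom_ext <;> simp [hθ p q r hpq hqr]

variable {K I : Cplx R} (θ : ∀ p q : ℤ, p + 1 = q → (I.X p ⟶ K.X q))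
  (hθ : ∀ p q r hpq hqr, θ p q hpq ≫ K.d q r = -(I.d p q ≫ θ q r hqr))

/-- The first projection from the terms of a twisted extension. -/
noncomputable def twistFst (p : ℤ) : (twist K I θ hθ).X p ⟶ K.X p :=
  (biprod.fst : K.X p ⊞ I.X p ⟶ _)

/-- The second projection from the terms of a twisted extension. -/
noncomputable def twistSnd (p : ℤ) : (twist K I θ hθ).X p ⟶ I.X p :=
  (biprod.snd : K.X p ⊞ I.X p ⟶ _)

/-- Morphisms to the terms of a twisted extension. -/
noncomputable def twistLift {P : ModuleCat.{u} R} {p : ℤ} (x : P ⟶ K.X p) (y : P ⟶ I.X p) :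
    P ⟶ (twist K I θ hθ).X p :=
  biprod.lift x y

variable {θ hθ} in
lemma twist_hom_ext {P : ModuleCat.{u} R} {p : ℤ} {x y : P ⟶ (twist K I θ hθ).X p}
    (h₁ : x ≫ twistFst θ hθ p = y ≫ twistFst θ hθ p)
    (h₂ : x ≫ twistSnd θ hθ p = y ≫ twistSnd θ hθ p) : x = y :=
  biprod.hom_ext _ _ h₁ h₂

@[simp]
lemma twistLift_fst {P : ModuleCat.{u} R} {p : ℤ} (x : P ⟶ K.X p) (y : P ⟶ I.X p) :
    twistLift θ hθ x y ≫ twistFst θ hθ p = x :=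
  biprod.lift_fst x y

@[simp]
lemma twistLift_snd {P : ModuleCat.{u} R} {p : ℤ} (x : P ⟶ K.X p) (y : P ⟶ I.X p) :
    twistLift θ hθ x y ≫ twistSnd θ hθ p = y :=
  biprod.lift_snd x y

lemma twist_d_fst {p q : ℤ} (h : p + 1 = q) : (twist K I θ hθ).d p q ≫ twistFst θ hθ q =
    twistFst θ hθ p ≫ K.d p q + twistSnd θ hθ p ≫ θ p q h := by
  dsimp only [twist]
  rw [dif_pos h]
  exact biprod.lift_fst _ _

lemma twist_d_snd {p q : ℤ} (h : p + 1 = q) : (twist K I θ hθ).d p q ≫ twistSnd θ hθ q =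
    twistSnd θ hθ p ≫ I.d p q := by
  dsimp only [twist]
  rw [dif_pos h]
  exact biprod.lift_snd _ _

lemma twistLift_d {P : ModuleCat.{u} R} {p q : ℤ} (h : p + 1 = q) (x : P ⟶ K.X p)
    (y : P ⟶ I.X p) : twistLift θ hθ x y ≫ (twist K I θ hθ).d p q =
      twistLift θ hθ (x ≫ K.d p q + y ≫ θ p q h) (y ≫ I.d p q) :=
  twist_hom_ext
    (by rw [Category.assoc, twist_d_fst θ hθ h, Preadditive.comp_add, ← Category.assoc,
      ← Category.assoc, twistLift_fst, twistLift_snd, twistLift_fst])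
    (by rw [Category.assoc, twist_d_snd θ hθ h, ← Category.assoc, twistLift_snd, twistLift_snd])

lemma comp_twistLift {P P' : ModuleCat.{u} R} {p : ℤ} (z : P' ⟶ P) (x : P ⟶ K.X p)
    (y : P ⟶ I.X p) : z ≫ twistLift θ hθ x y = twistLift θ hθ (z ≫ x) (z ≫ y) :=
  twist_hom_ext (by simp) (by simp)

lemma twistLift_add {P : ModuleCat.{u} R} {p : ℤ} (x x' : P ⟶ K.X p) (y y' : P ⟶ I.X p) :
    twistLift θ hθ x y + twistLift θ hθ x' y' = twistLift θ hθ (x + x') (y + y') :=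
  twist_hom_ext (by simp) (by simp)

lemma exists_eq_twistLift {P : ModuleCat.{u} R} {p : ℤ} (z : P ⟶ (twist K I θ hθ).X p) :
    ∃ x y, z = twistLift θ hθ x y :=
  ⟨z ≫ twistFst θ hθ p, z ≫ twistSnd θ hθ p, twist_hom_ext (by simp) (by simp)⟩

lemma twistLift_inj {P : ModuleCat.{u} R} {p : ℤ} {x x' : P ⟶ K.X p} {y y' : P ⟶ I.X p} :
    twistLift θ hθ x y = twistLift θ hθ x' y' ↔ x = x' ∧ y = y' :=
  ⟨fun h ↦ ⟨by simpa using h =≫ twistFst θ hθ p, by simpa using h =≫ twistSnd θ hθ p⟩,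
    fun ⟨h, h'⟩ ↦ by rw [h, h']⟩

lemma isZero_twist {p : ℤ} (hK : IsZero (K.X p)) (hI : IsZero (I.X p)) :
    IsZero ((twist K I θ hθ).X p) := by
  rw [IsZero.iff_id_eq_zero]
  exact twist_hom_ext (hK.eq_of_tgt _ _) (hI.eq_of_tgt _ _)

lemma isPI_twist {p : ℤ} (hK : IsPI (K.X p)) (hI : IsPI (I.X p)) :
    IsPI ((twist K I θ hθ).X p) := by
  intro A hA a b c hab hbc φ hφ
  obtain ⟨ψ, hψ⟩ := hK A hA a b c hab hbc (φ ≫ twistFst θ hθ p) (by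
    rw [← Category.assoc, hφ, zero_comp])
  obtain ⟨ψ', hψ'⟩ := hI A hA a b c hab hbc (φ ≫ twistSnd θ hθ p) (by
    rw [← Category.assoc, hφ, zero_comp])
  exact ⟨twistLift θ hθ ψ ψ', twist_hom_ext (by simp [hψ]) (by simp [hψ'])⟩

lemma isBoundedBelow_twist (hK : IsBoundedBelow K) (hI : IsBoundedBelow I) :
    IsBoundedBelow (twist K I θ hθ) := by
  obtain ⟨a, ha⟩ := hK
  obtain ⟨b, hb⟩ := hI
  exact ⟨min a b, fun i hi ↦ isZero_twist θ hθ (ha i (by lia)) (hb i (by lia))⟩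

end Twist
end PureRes

namespace PureRes

open CochainComplex CochainComplex.HomComplex

/-! ### Replacing a morphism by a degreewise split epimorphism. -/

section Extension

variable {R : Type u} [CommRing R]

/-- The family of isomorphisms of degree `1` from `I` to its shift. -/
noncomputable def shiftFamily (I : Cplx R) (p q : ℤ) (h : p + 1 = q) :
    I.X p ≅ (I⟦(-1 : ℤ)⟧).X q :=
  (I.shiftFunctorObjXIso (-1) q p (by lia)).symm

lemma shiftFamily_hom_d (I : Cplx R) (p q r : ℤ) (hpq : p + 1 = q) (hqr : q + 1 = r) :
    (shiftFamily I p q hpq).hom ≫ (I⟦(-1 : ℤ)⟧).d q r =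
      -(I.d p q ≫ (shiftFamily I q r hqr).hom) := by
  let σ : Cochain I (I⟦(-1 : ℤ)⟧) 1 := (Cochain.ofHom (𝟙 I)).rightShift (-1) 1 (by simp)
  have hσ (p q h) : σ.v p q h = (shiftFamily I p q h).hom := by
    rw [Cochain.rightShift_v _ _ _ _ p q h p (by lia), Cochain.ofHom_v, HomologicalComplex.id_f,
      Category.id_comp]
    rfl
  rw [← hσ, ← hσ]
  refine v_comp_d_of_δ_eq_zero σ ?_ p q r hpq hqr
  rw [Cochain.δ_rightShift _ (-1) 1 2 _ 1 (by lia)]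
  simp

/-- Only these properties of the shift are used later; stating them alone keeps its sign conventions
out of the computations. -/
lemma exists_shift (I : Cplx R) : ∃ (J : Cplx R) (σ : ∀ p q : ℤ, p + 1 = q → (I.X p ≅ J.X q)),
    (∀ p q r hpq hqr, (σ p q hpq).hom ≫ J.d q r = -(I.d p q ≫ (σ q r hqr).hom)) ∧
      (IsBoundedBelow I → IsBoundedBelow J) :=
  ⟨I⟦(-1 : ℤ)⟧, shiftFamily I, shiftFamily_hom_d I, fun ⟨a, ha⟩ ↦
    ⟨a, fun i hi ↦ (ha (i - 1) (by lia)).of_iso (shiftFamily I (i - 1) i (by lia)).symm⟩⟩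

/-- A morphism from a bounded below complex to a bounded below complex of pure injectives
factors as a resolution followed by a degreewise split epimorphism. -/
lemma exists_factorization {T I : Cplx R} (φ : T ⟶ I) (hT : IsBoundedBelow T)
    (hI : IsBoundedBelow I) (hI' : ∀ i, IsPI (I.X i)) :
    ∃ (I' : Cplx R) (f : T ⟶ I') (q : I' ⟶ I), IsBoundedBelow I' ∧ (∀ i, IsPI (I'.X i)) ∧
      IsHomQuasiIso f ∧ f ≫ q = φ ∧ ∀ i, ∃ s, s ≫ q.f i = 𝟙 (I.X i) := by
  obtain ⟨J, σ, hσ, hJ⟩ := exists_shift I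
  -- The twist by `ψ` is the mapping fibre of `φ`, an extension of `T` by the shift of `I`. Its
  -- resolution `K` will be the kernel of `q`.
  let ψ (p q : ℤ) (h : p + 1 = q) : T.X p ⟶ J.X q := φ.f p ≫ (σ p q h).hom
  have hψ (p q r hpq hqr) : ψ p q hpq ≫ J.d q r = -(T.d p q ≫ ψ q r hqr) := by
    simp [ψ, hσ p q r hpq hqr]
  obtain ⟨K, ρ, hK, hK', hρ⟩ := exists_resolution (isBoundedBelow_twist ψ hψ (hJ hI) hT)
  -- The sign is the one that makes `f = (ρ(0, _), φ)` commute with the differentials, since the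
  -- differential of `(0, t)` in the fibre has first component `σ (φ t)`.
  let θ (p q : ℤ) (h : p + 1 = q) : I.X p ⟶ K.X q :=
    twistLift ψ hψ (-(σ p q h).hom) 0 ≫ ρ.f q
  have hθ (p q r hpq hqr) : θ p q hpq ≫ K.d q r = -(I.d p q ≫ θ q r hqr) := by
    dsimp only [θ]
    rw [Category.assoc, ρ.comm, ← Category.assoc, twistLift_d ψ hψ hqr, ← Category.assoc (I.d p q),
      comp_twistLift, ← Preadditive.neg_comp]
    congr 1
    refine twist_hom_ext ?_ ?_
    · simp [hσ p q r hpq hqr]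
    · simp
  have hρθ {P : ModuleCat.{u} R} {p q : ℤ} (h : p + 1 = q) (x : P ⟶ T.X q) (y : P ⟶ I.X p) :
      twistLift ψ hψ (-(y ≫ (σ p q h).hom)) x ≫ ρ.f q =
        x ≫ twistLift ψ hψ 0 (𝟙 _) ≫ ρ.f q + y ≫ θ p q h := by
    dsimp only [θ]
    rw [← Category.assoc, ← Category.assoc, comp_twistLift, comp_twistLift,
      ← Preadditive.add_comp, twistLift_add]
    simp
  let f : T ⟶ twist K I θ hθ :=
    { f p := twistLift θ hθ (twistLift ψ hψ 0 (𝟙 _) ≫ ρ.f p) (φ.f p)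
      comm' p q (h : p + 1 = q) := by
        rw [twistLift_d θ hθ h, comp_twistLift, twistLift_inj]
        refine ⟨?_, φ.comm p q⟩
        rw [Category.assoc, ρ.comm, ← Category.assoc, twistLift_d ψ hψ h]
        have := hρθ h (T.d p q) (-φ.f p)
        rw [Preadditive.neg_comp, neg_neg, Preadditive.neg_comp] at this
        rw [zero_comp, zero_add, Category.id_comp, Category.id_comp, this]
        abel }
  have hf (p) : f.f p = twistLift θ hθ (twistLift ψ hψ 0 (𝟙 _) ≫ ρ.f p) (φ.f p) := rfl
  let q : twist K I θ hθ ⟶ I :=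
    { f := twistSnd θ hθ
      comm' p q h := (twist_d_snd θ hθ h).symm }
  refine ⟨_, f, q, isBoundedBelow_twist θ hθ hK hI, fun i ↦ isPI_twist θ hθ (hK' i) (hI' i), ?_,
    ?_, fun i ↦ ⟨twistLift θ hθ 0 (𝟙 _), twistLift_snd θ hθ _ _⟩⟩
  · intro P _ i j k l hij hjk hkl x z hx hxz
    obtain ⟨κ, y, rfl⟩ := exists_eq_twistLift θ hθ z
    rw [hf, comp_twistLift, twistLift_d θ hθ hjk, twistLift_add] at hxz
    have hxz₁ := hxz =≫ twistFst θ hθ k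
    have hxz₂ := hxz =≫ twistSnd θ hθ k
    simp only [twistLift_fst, twistLift_snd, zero_comp] at hxz₁ hxz₂
    -- The lifting problem for `f` with data `(x, (κ, y))` is the one for `ρ` with data `((-σ y, x),
    -- κ)`: the `I` component moves from the target to the fibre.
    obtain ⟨v, κ', h₁, h₂⟩ := hρ P i j k l hij hjk hkl
      (twistLift ψ hψ (-(y ≫ (σ j k hjk).hom)) x) κ
      (by
        rw [twistLift_d ψ hψ hkl, hx]
        refine twist_hom_ext ?_ (by simp)
        have := hxz₂ =≫ (σ k l hkl).hom
        simpa [ψ, hσ j k l hjk hkl, add_comm] using this)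
      (by
        rw [hρθ hjk, ← hxz₁]
        abel)
    obtain ⟨v₁, x', rfl⟩ := exists_eq_twistLift ψ hψ v
    obtain ⟨y', rfl⟩ : ∃ y', v₁ = -(y' ≫ (σ i j hij).hom) := ⟨-(v₁ ≫ (σ i j hij).inv), by simp⟩
    rw [twistLift_d ψ hψ hjk] at h₁
    have h₁₁ := h₁ =≫ twistFst ψ hψ k
    have h₁₂ := h₁ =≫ twistSnd ψ hψ k
    refine ⟨x', twistLift θ hθ κ' y', by simpa using h₁₂, ?_⟩
    rw [hf, comp_twistLift, twistLift_d θ hθ hij, twistLift_add, twistLift_inj]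
    refine ⟨?_, ?_⟩
    · rw [← h₂, hρθ hij]
      abel
    · rw [← cancel_mono (σ j k hjk).hom]
      simpa [ψ, hσ i j k hij hjk, add_comm] using h₁₁
  · ext p : 1
    exact twistLift_snd θ hθ _ _

end Extension
end PureRes

namespace PureRes

open CochainComplex CochainComplex.HomComplex

/-! ### Mittag-Leffler arguments for limits of degreewise split towers. -/

section Towers

/-- A Mittag-Leffler argument: if `V n ⟶ W n ⟶ X n` is exact for all `n` and the transition maps
of `V` are surjective, then a compatible family in `X` with local preimages in `W` has a compatible
family of preimages. -/
lemma exists_compatible_preimages {V W X : ℕ → Type*} [∀ n, AddCommGroup (V n)]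
    [∀ n, AddCommGroup (W n)] [∀ n, AddCommGroup (X n)] (tV : ∀ n, V (n + 1) →+ V n)
    (tW : ∀ n, W (n + 1) →+ W n) (tX : ∀ n, X (n + 1) →+ X n) (a : ∀ n, V n →+ W n)
    (b : ∀ n, W n →+ X n) (ha : ∀ n v, a n (tV n v) = tW n (a (n + 1) v))
    (hb : ∀ n w, b n (tW n w) = tX n (b (n + 1) w)) (hba : ∀ n v, b n (a n v) = 0)
    (hW : ∀ n w, b n w = 0 → ∃ v, a n v = w) (hV : ∀ n, Function.Surjective (tV n))
    (x : ∀ n, X n) (hx : ∀ n, tX n (x (n + 1)) = x n) (hX : ∀ n, ∃ w, b n w = x n) :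
    ∃ w : ∀ n, W n, (∀ n, tW n (w (n + 1)) = w n) ∧ ∀ n, b n (w n) = x n := by
  have step (n : ℕ) (w : {w // b n w = x n}) :
      ∃ w' : {w // b (n + 1) w = x (n + 1)}, tW n w' = w := by
    -- An arbitrary preimage at level `n + 1` is compatible with `w` up to an element of the image
    -- of `a n`, which lifts to level `n + 1` and is subtracted there.
    obtain ⟨w', hw'⟩ := hX (n + 1)
    obtain ⟨v, hv⟩ := hW n (tW n w' - w) (by rw [map_sub, hb, hw', hx, w.2, sub_self])
    obtain ⟨v', rfl⟩ := hV n v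
    exact ⟨⟨w' - a (n + 1) v', by rw [map_sub, hba, hw', sub_zero]⟩, by simp [← ha, hv]⟩
  choose next hnext using step
  let w (n : ℕ) : {w // b n w = x n} :=
    Nat.rec ⟨(hX 0).choose, (hX 0).choose_spec⟩ (fun n w ↦ next n w) n
  exact ⟨fun n ↦ (w n).1, fun n ↦ hnext n (w n), fun n ↦ (w n).2⟩

lemma exists_lift_of_compatible {C : Type*} [Category C] {S : ℕᵒᵖ ⥤ C} {c : Cone S}
    (hc : IsLimit c) {P : C} (w : ∀ n : ℕ, P ⟶ S.obj (Opposite.op n))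
    (hw : ∀ n : ℕ, w (n + 1) ≫ S.map (homOfLE n.le_succ).op = w n) :
    ∃ l : P ⟶ c.pt, ∀ n : ℕ, l ≫ c.π.app (Opposite.op n) = w n :=
  ⟨hc.lift (Cone.mk P (NatTrans.ofOpSequence (F := (Functor.const ℕᵒᵖ).obj P) w fun n ↦ by
    rw [hw]; exact Category.id_comp _)), fun n ↦ hc.fac _ _⟩

variable {R : Type u} [CommRing R]

/-- Factorizations exist at each level; the sections make the transition maps on `Hom(A.X (k + 1),
_)` surjective, so the factorizations can be chosen compatibly. -/
lemma isPI_of_isLimit {S : ℕᵒᵖ ⥤ ModuleCat.{u} R} {c : Cone S} (hc : IsLimit c)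
    (hS : ∀ n, IsPI (S.obj n))
    (hsec : ∀ n : ℕ, ∃ s, s ≫ S.map (homOfLE n.le_succ).op = 𝟙 (S.obj (Opposite.op n))) :
    IsPI c.pt := by
  intro A hA i j k hij hjk φ hφ
  let t (n : ℕ) : S.obj (Opposite.op (n + 1)) ⟶ S.obj (Opposite.op n) :=
    S.map (homOfLE n.le_succ).op
  have hw (n : ℕ) : c.π.app (Opposite.op (n + 1)) ≫ t n = c.π.app (Opposite.op n) := c.w _
  obtain ⟨w, hw, hw'⟩ := exists_compatible_preimages
    (V := fun n ↦ A.X (k + 1) ⟶ S.obj (Opposite.op n))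
    (W := fun n ↦ A.X k ⟶ S.obj (Opposite.op n)) (X := fun n ↦ A.X j ⟶ S.obj (Opposite.op n))
    (fun n ↦ Preadditive.rightComp (A.X (k + 1)) (t n))
    (fun n ↦ Preadditive.rightComp (A.X k) (t n))
    (fun n ↦ Preadditive.rightComp (A.X j) (t n))
    (fun n ↦ Preadditive.leftComp _ (A.d k (k + 1)))
    (fun n ↦ Preadditive.leftComp _ (A.d j k))
    (fun n v ↦ (Category.assoc (A.d k (k + 1)) v (t n)).symm)
    (fun n w ↦ (Category.assoc (A.d j k) w (t n)).symm)
    (fun n v ↦ by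
      change A.d j k ≫ A.d k (k + 1) ≫ v = 0
      simp)
    (fun n w h ↦ hS _ A hA j k (k + 1) hjk rfl w h)
    (fun n v ↦ by
      obtain ⟨s, hs⟩ := hsec n
      refine ⟨v ≫ s, ?_⟩
      change (v ≫ s) ≫ t n = v
      rw [Category.assoc, hs, Category.comp_id])
    (fun n ↦ φ ≫ c.π.app (Opposite.op n))
    (fun n ↦ (Category.assoc _ _ (t n)).trans (by rw [hw]))
    (fun n ↦ hS _ A hA i j k hij hjk _ (by rw [← Category.assoc, hφ, zero_comp]))
  obtain ⟨l, hl⟩ := exists_lift_of_compatible hc w hw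
  refine ⟨l, hc.hom_ext fun n ↦ ?_⟩
  rw [Category.assoc, hl n.unop]
  exact hw' n.unop

lemma exists_lift_X_of_compatible {S : ℕᵒᵖ ⥤ Cplx R} {c : Cone S} (hc : IsLimit c) (q : ℤ)
    {P : ModuleCat.{u} R} (w : ∀ n : ℕ, P ⟶ (S.obj (Opposite.op n)).X q)
    (hw : ∀ n : ℕ, w (n + 1) ≫ (transition S n).f q = w n) :
    ∃ l : P ⟶ c.pt.X q, ∀ n : ℕ, l ≫ (c.π.app (Opposite.op n)).f q = w n :=
  exists_lift_of_compatible (isLimitOfPreserves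
    (HomologicalComplex.eval (ModuleCat.{u} R) (ComplexShape.up ℤ) q) hc) w hw

lemma hom_ext_X {S : ℕᵒᵖ ⥤ Cplx R} {c : Cone S} (hc : IsLimit c) {q : ℤ} {P : ModuleCat.{u} R}
    {x y : P ⟶ c.pt.X q}
    (h : ∀ n : ℕ, x ≫ (c.π.app (Opposite.op n)).f q = y ≫ (c.π.app (Opposite.op n)).f q) : x = y :=
  (isLimitOfPreserves (HomologicalComplex.eval (ModuleCat.{u} R) (ComplexShape.up ℤ) q)
    hc).hom_ext fun n ↦ h n.unop

/-- Composition of cochains with a morphism of complexes. -/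
noncomputable def cochainRightComp (A : Cplx R) {I J : Cplx R} (t : I ⟶ J) (n : ℤ) :
    Cochain A I n →+ Cochain A J n :=
  AddMonoidHom.mk' (fun z ↦ z.comp (Cochain.ofHom t) (add_zero n)) fun _ _ ↦ Cochain.add_comp _ _ _ _

/-- The same argument for cochain groups in degrees `m - 1`, `m`, `n`. Cochains ignore
differentials, so degreewise sections suffice for surjectivity. -/
lemma isKPI_of_isLimit {S : ℕᵒᵖ ⥤ Cplx R} {c : Cone S} (hc : IsLimit c)
    (hS : ∀ n, IsKPI (S.obj n))
    (hsec : ∀ (n : ℕ) (i : ℤ), ∃ s, s ≫ (transition S n).f i = 𝟙 _) : IsKPI c.pt := by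
  intro A hA m n k hmn hnk z hz
  have hw (r : ℕ) : c.π.app (Opposite.op (r + 1)) ≫ transition S r = c.π.app (Opposite.op r) :=
    c.w _
  obtain ⟨w, hw, hw'⟩ := exists_compatible_preimages
    (V := fun r ↦ Cochain A (S.obj (Opposite.op r)) (m - 1))
    (W := fun r ↦ Cochain A (S.obj (Opposite.op r)) m)
    (X := fun r ↦ Cochain A (S.obj (Opposite.op r)) n)
    (fun r ↦ cochainRightComp A (transition S r) (m - 1))
    (fun r ↦ cochainRightComp A (transition S r) m)
    (fun r ↦ cochainRightComp A (transition S r) n)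
    (fun r ↦ (δ_hom ℤ A _ (m - 1) m).toAddMonoidHom)
    (fun r ↦ (δ_hom ℤ A _ m n).toAddMonoidHom)
    (fun r v ↦ δ_comp_ofHom v (transition S r) m)
    (fun r w ↦ δ_comp_ofHom w (transition S r) n) (fun r v ↦ δ_δ (m - 1) m n v)
    (fun r w h ↦ hS _ A hA (m - 1) m n (by lia) hmn w h)
    (fun r v ↦ by
      choose s hs using hsec r
      refine ⟨Cochain.mk fun p q hpq ↦ v.v p q hpq ≫ s q, Cochain.ext _ _ fun p q hpq ↦ ?_⟩
      simp [cochainRightComp, hs])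
    (fun r ↦ z.comp (Cochain.ofHom (c.π.app (Opposite.op r))) (add_zero n))
    (fun r ↦ by
      refine Cochain.ext _ _ fun p q hpq ↦ ?_
      simp [cochainRightComp, ← HomologicalComplex.comp_f, hw r])
    (fun r ↦ hS _ A hA m n k hmn hnk _ (by rw [δ_comp_ofHom, hz, Cochain.zero_comp]))
  choose l hl using fun (p q : ℤ) (hpq : p + m = q) ↦ exists_lift_X_of_compatible hc q
    (fun r ↦ (w r).v p q hpq) (fun r ↦ by
      simpa [cochainRightComp] using Cochain.congr_v (hw r) p q hpq)
  let α : Cochain A c.pt m := Cochain.mk l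
  have hα (r : ℕ) : α.comp (Cochain.ofHom (c.π.app (Opposite.op r))) (add_zero m) = w r := by
    refine Cochain.ext _ _ fun p q hpq ↦ ?_
    rw [Cochain.comp_zero_cochain_v, Cochain.ofHom_v]
    exact hl p q hpq r
  refine ⟨α, Cochain.ext _ _ fun p q hpq ↦ hom_ext_X hc fun r ↦ ?_⟩
  have h₁ : (δ m n α).comp (Cochain.ofHom (c.π.app (Opposite.op r))) (add_zero n) =
      z.comp (Cochain.ofHom (c.π.app (Opposite.op r))) (add_zero n) := by
    rw [← δ_comp_ofHom, hα r]
    exact hw' r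
  simpa using Cochain.congr_v h₁ p q hpq

end Towers
end PureRes

namespace PureRes

open CochainComplex CochainComplex.HomComplex

/-! ### The limit of the tower of resolutions. -/

section Main

variable {R : Type u} [CommRing R]

lemma isIso_πTruncGE_f (M : Cplx R) (n i : ℤ) (hi : n < i) : IsIso ((M.πTruncGE n).f i) := by
  have h : (ComplexShape.embeddingUpIntGE n).f (i - n).toNat = i := by
    change n + ((i - n).toNat : ℤ) = i
    lia
  exact ((ComplexShape.embeddingUpIntGE n).isIso_liftExtend_f_iff _
    (HomologicalComplex.restrictionToTruncGE'_hasLift M (ComplexShape.embeddingUpIntGE n)) h).2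
    (HomologicalComplex.isIso_restrictionToTruncGE' _ _ _ (by
      rw [ComplexShape.boundaryGE_embeddingUpIntGE_iff]
      lia))

/-- The condition `IsHomQuasiIso` can be checked in low degrees on a factorization through a
morphism which is an isomorphism in the relevant degrees. -/
lemma IsHomQuasiIso.exists_of_isIso {M T I : Cplx R} {f : T ⟶ I} (hf : IsHomQuasiIso f)
    (π : M ⟶ T) {P : ModuleCat.{u} R} [Module.FinitePresentation R P] {i j k l : ℤ}
    (hij : i + 1 = j) (hjk : j + 1 = k) (hkl : k + 1 = l) (hj : IsIso (π.f j)) (hk : IsIso (π.f k))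
    (x : P ⟶ M.X k) (y : P ⟶ I.X j) (hx : x ≫ M.d k l = 0)
    (hxy : x ≫ (π ≫ f).f k + y ≫ I.d j k = 0) :
    ∃ (x' : P ⟶ M.X j) (y' : P ⟶ I.X i),
        x' ≫ M.d j k = -x ∧ x' ≫ (π ≫ f).f j + y' ≫ I.d i j = y := by
  obtain ⟨x', y', h₁, h₂⟩ := hf P i j k l hij hjk hkl (x ≫ π.f k) y
    (by rw [Category.assoc, π.comm, ← Category.assoc, hx, zero_comp])
    (by simpa using hxy)
  refine ⟨x' ≫ inv (π.f j), y', ?_, by simpa using h₂⟩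
  rw [← cancel_mono (π.f k), Category.assoc, Category.assoc, ← π.comm, IsIso.inv_hom_id_assoc, h₁,
    Preadditive.neg_comp]

/-- The differential of the mapping cone of `f`, after applying `Hom(P, _)`. -/
def homConeD (P : ModuleCat.{u} R) {M I : Cplx R} (f : M ⟶ I) (i j k : ℤ) :
    (P ⟶ M.X j) × (P ⟶ I.X i) →+ (P ⟶ M.X k) × (P ⟶ I.X j) :=
  AddMonoidHom.mk' (fun v ↦ (-(v.1 ≫ M.d j k), v.1 ≫ f.f j + v.2 ≫ I.d i j)) fun v w ↦ by
    ext : 1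
    · simp [add_comm]
    · simp [add_add_add_comm]

lemma homConeD_apply (P : ModuleCat.{u} R) {M I : Cplx R} (f : M ⟶ I) (i j k : ℤ)
    (x : P ⟶ M.X j) (y : P ⟶ I.X i) :
    homConeD P f i j k (x, y) = (-(x ≫ M.d j k), x ≫ f.f j + y ≫ I.d i j) := rfl

lemma homConeD_comp (P : ModuleCat.{u} R) {M I : Cplx R} (f : M ⟶ I) (h i j k : ℤ)
    (v : (P ⟶ M.X i) × (P ⟶ I.X h)) :
    homConeD P f i j k (homConeD P f h i j v) = 0 := by
  obtain ⟨x, y⟩ := v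
  simp [homConeD_apply]

/-- The functoriality of the mapping cone, after applying `Hom(P, _)`. -/
def homConeMap (P : ModuleCat.{u} R) (M : Cplx R) {I J : Cplx R} (t : I ⟶ J) (i j : ℤ) :
    (P ⟶ M.X j) × (P ⟶ I.X i) →+ (P ⟶ M.X j) × (P ⟶ J.X i) :=
  (AddMonoidHom.id _).prodMap (Preadditive.rightComp P (t.f i))

lemma homConeMap_apply (P : ModuleCat.{u} R) (M : Cplx R) {I J : Cplx R} (t : I ⟶ J) (i j : ℤ)
    (x : P ⟶ M.X j) (y : P ⟶ I.X i) : homConeMap P M t i j (x, y) = (x, y ≫ t.f i) := rfl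

lemma homConeD_homConeMap (P : ModuleCat.{u} R) {M I J : Cplx R} (f : M ⟶ I) (f' : M ⟶ J)
    (t : I ⟶ J) (ht : f ≫ t = f') (i j k : ℤ) (v : (P ⟶ M.X j) × (P ⟶ I.X i)) :
    homConeD P f' i j k (homConeMap P M t i j v) = homConeMap P M t j k (homConeD P f i j k v) := by
  obtain ⟨x, y⟩ := v
  subst ht
  simp [homConeD_apply, homConeMap_apply]

/-- The limit of resolutions of truncations is a resolution. -/
lemma isHomQuasiIso_of_isLimit (M : Cplx R) {S : ℕᵒᵖ ⥤ Cplx R} {c : Cone S} (hc : IsLimit c)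
    (hsec : ∀ (n : ℕ) (i : ℤ), ∃ s, s ≫ (transition S n).f i = 𝟙 _)
    (f : truncSystem M ⟶ S) (hf : ∀ n, IsHomQuasiIso (f.app n)) (g : M ⟶ c.pt)
    (hg : ∀ n : ℕ, g ≫ c.π.app (Opposite.op n) =
      M.πTruncGE (-(n : ℤ)) ≫ f.app (Opposite.op n)) : IsHomQuasiIso g := by
  intro P _ i j k l hij hjk hkl x y hx hxy
  -- From stage `N` on, the projection of `M` to its truncation is an isomorphism in all degrees at
  -- least `i`. This allows lifting both for the given data and for the corrections one degree
  -- lower.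
  let N : ℕ := (1 - i).toNat
  let J (n : ℕ) : Cplx R := S.obj (Opposite.op (N + n))
  let t (n : ℕ) : J (n + 1) ⟶ J n := transition S (N + n)
  let γ (n : ℕ) : M ⟶ J n := g ≫ c.π.app (Opposite.op (N + n))
  have hγt (n : ℕ) : γ (n + 1) ≫ t n = γ n := by
    simp only [γ, Category.assoc]
    congr 1
    exact c.w _
  have hγ (n : ℕ) {i j k l : ℤ} (hij : i + 1 = j) (hjk : j + 1 = k) (hkl : k + 1 = l)
      (hj : 1 - (N : ℤ) ≤ j) (x : P ⟶ M.X k) (y : P ⟶ (J n).X j) (hx : x ≫ M.d k l = 0)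
      (hxy : x ≫ (γ n).f k + y ≫ (J n).d j k = 0) : ∃ (x' : P ⟶ M.X j) (y' : P ⟶ (J n).X i),
        x' ≫ M.d j k = -x ∧ x' ≫ (γ n).f j + y' ≫ (J n).d i j = y := by
    have e : γ n = M.πTruncGE (-((N + n : ℕ) : ℤ)) ≫ f.app (Opposite.op (N + n)) := hg (N + n)
    rw [e] at hxy ⊢
    exact (hf (Opposite.op (N + n))).exists_of_isIso (M.πTruncGE _) hij hjk hkl
      (isIso_πTruncGE_f M _ j (by push_cast; lia)) (isIso_πTruncGE_f M _ k (by push_cast; lia))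
      x y hx hxy
  -- Mittag-Leffler for the complexes `Hom(P, cone (γ n))`: the component in `M` is constant along
  -- the tower, and the component in `J n` has surjective transition maps by the sections.
  obtain ⟨w, hw, hw'⟩ := exists_compatible_preimages
    (V := fun n ↦ (P ⟶ M.X i) × (P ⟶ (J n).X (i - 1)))
    (W := fun n ↦ (P ⟶ M.X j) × (P ⟶ (J n).X i))
    (X := fun n ↦ (P ⟶ M.X k) × (P ⟶ (J n).X j))
    (fun n ↦ homConeMap P M (t n) (i - 1) i) (fun n ↦ homConeMap P M (t n) i j)
    (fun n ↦ homConeMap P M (t n) j k) (fun n ↦ homConeD P (γ n) (i - 1) i j)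
    (fun n ↦ homConeD P (γ n) i j k)
    (fun n v ↦ homConeD_homConeMap P _ _ _ (hγt n) _ _ _ v)
    (fun n w ↦ homConeD_homConeMap P _ _ _ (hγt n) _ _ _ w)
    (fun n v ↦ homConeD_comp P _ _ _ _ _ v)
    (fun n ⟨x, y⟩ h ↦ by
      rw [homConeD_apply, Prod.mk_eq_zero, neg_eq_zero] at h
      obtain ⟨x', y', h₁, h₂⟩ := hγ n (sub_add_cancel i 1) hij hjk (by lia) x y h.1 h.2
      exact ⟨(x', y'), by rw [homConeD_apply, h₁, h₂, neg_neg]⟩)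
    (fun n ⟨x, y⟩ ↦ by
      obtain ⟨s, hs⟩ := hsec (N + n) (i - 1)
      refine ⟨(x, y ≫ s), ?_⟩
      rw [homConeMap_apply, Category.assoc, hs, Category.comp_id])
    (fun n ↦ (x, y ≫ (c.π.app (Opposite.op (N + n))).f j))
    (fun n ↦ by
      rw [homConeMap_apply, Category.assoc, ← HomologicalComplex.comp_f]
      congr 4
      exact c.w _)
    (fun n ↦ by
      obtain ⟨x', y', h₁, h₂⟩ := hγ n hij hjk hkl (by lia) x
        (y ≫ (c.π.app (Opposite.op (N + n))).f j) hx (by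
          have := hxy =≫ (c.π.app (Opposite.op (N + n))).f k
          rw [Preadditive.add_comp, Category.assoc, Category.assoc,
            ← HomologicalComplex.Hom.comm, zero_comp] at this
          simp only [γ, HomologicalComplex.comp_f, Category.assoc]
          exact this)
      exact ⟨(x', y'), by rw [homConeD_apply, h₁, h₂, neg_neg]⟩)
  -- These maps return from the reindexed tower to the original one, whose limit is `c`.
  let r (n : ℕ) : J n ⟶ S.obj (Opposite.op n) := S.map (homOfLE (Nat.le_add_left n N)).op
  have hr (n : ℕ) : r (n + 1) ≫ transition S n = t n ≫ r n := by
    simp only [r, t, transition, ← S.map_comp]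
    rfl
  have hcr (n : ℕ) : c.π.app (Opposite.op (N + n)) ≫ r n = c.π.app (Opposite.op n) := c.w _
  obtain ⟨x', hx'⟩ : ∃ x', ∀ n, (w n).1 = x' := ⟨(w 0).1, fun n ↦ by
    induction n with
    | zero => rfl
    | succ n ih => exact (congr_arg Prod.fst (hw n)).trans ih⟩
  obtain ⟨y', hy'⟩ := exists_lift_X_of_compatible hc i (fun n ↦ (w n).2 ≫ (r n).f i) (fun n ↦ by
    rw [Category.assoc, ← HomologicalComplex.comp_f, hr, HomologicalComplex.comp_f,
      ← Category.assoc]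
    exact congr_arg (· ≫ (r n).f i) (congr_arg Prod.snd (hw n)))
  have hw₁ (n : ℕ) : -((w n).1 ≫ M.d j k) = x := congr_arg Prod.fst (hw' n)
  have hw₂ (n : ℕ) : (w n).1 ≫ (γ n).f j + (w n).2 ≫ (J n).d i j =
    y ≫ (c.π.app (Opposite.op (N + n))).f j := congr_arg Prod.snd (hw' n)
  refine ⟨x', y', by rw [← hx' 0, ← hw₁ 0, neg_neg], hom_ext_X hc fun n ↦ ?_⟩
  have := hw₂ n =≫ (r n).f j
  rw [Preadditive.add_comp, Category.assoc, Category.assoc, Category.assoc,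
    ← HomologicalComplex.comp_f, ← HomologicalComplex.comp_f, hcr, hx'] at this
  rw [← this, Preadditive.add_comp, Category.assoc, Category.assoc,
    ← HomologicalComplex.Hom.comm, ← Category.assoc y', hy', ← hcr n]
  simp [γ]

/-- A bounded below pure injective resolution. -/
structure BoundedResolution (T : Cplx R) where
  /-- the resolving complex -/
  I : Cplx R
  /-- the augmentation -/
  f : T ⟶ I
  isBoundedBelow : IsBoundedBelow I
  isPI : ∀ i, IsPI (I.X i)
  isHomQuasiIso : IsHomQuasiIso f

/-- Inverse systems of bounded below complexes have compatible pure injective resolutions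
with degreewise split transition morphisms. -/
lemma exists_resolution_tower (T : ℕᵒᵖ ⥤ Cplx R) (hT : ∀ n, IsBoundedBelow (T.obj n)) :
    ∃ (S : ℕᵒᵖ ⥤ Cplx R) (f : T ⟶ S), (∀ n, IsBoundedBelow (S.obj n)) ∧
      (∀ n i, IsPI ((S.obj n).X i)) ∧ (∀ n, IsHomQuasiIso (f.app n)) ∧
      ∀ (n : ℕ) (i : ℤ), ∃ s, s ≫ (transition S n).f i = 𝟙 _ := by
  have step (n : ℕ) (B : BoundedResolution (T.obj (Opposite.op n))) :
      -- Each stage resolves the composite of the truncation map with the previous augmentation, so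
      -- compatibility of the augmentations is built in.
      ∃ (B' : BoundedResolution (T.obj (Opposite.op (n + 1)))) (q : B'.I ⟶ B.I),
        transition T n ≫ B.f = B'.f ≫ q ∧ ∀ i, ∃ s, s ≫ q.f i = 𝟙 _ := by
    obtain ⟨I, f, q, h₁, h₂, h₃, h₄, h₅⟩ :=
      exists_factorization (transition T n ≫ B.f) (hT _) B.isBoundedBelow B.isPI
    exact ⟨⟨I, f, h₁, h₂, h₃⟩, q, h₄.symm, h₅⟩
  choose next q hq hs using step
  obtain ⟨I, f, h₁, h₂, h₃⟩ := exists_resolution (hT (Opposite.op 0))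
  let B (n : ℕ) : BoundedResolution (T.obj (Opposite.op n)) := Nat.rec ⟨I, f, h₁, h₂, h₃⟩ next n
  let t (n : ℕ) : (B (n + 1)).I ⟶ (B n).I := q n (B n)
  let S : ℕᵒᵖ ⥤ Cplx R := Functor.ofOpSequence (X := fun n ↦ (B n).I) t
  have ht (n : ℕ) : transition S n = t n :=
    Functor.ofOpSequence_map_homOfLE_succ (X := fun n ↦ (B n).I) t n
  refine ⟨S, NatTrans.ofOpSequence (fun n ↦ (B n).f) fun n ↦ ?_,
    fun n ↦ (B n.unop).isBoundedBelow, fun n ↦ (B n.unop).isPI, fun n ↦ (B n.unop).isHomQuasiIso,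
    fun n i ↦ ?_⟩
  · exact (hq n (B n)).trans (congr_arg ((B (n + 1)).f ≫ ·) (ht n).symm)
  · rw [ht]
    exact hs n (B n) i

/-- The sequence `Ker p ⟶ X ⟶ Y` splits in the degrees where `p` has a section. -/
lemma nonempty_splitting_kernelSequence {X Y : Cplx R} (p : X ⟶ Y) (i : ℤ)
    (h : ∃ s, s ≫ p.f i = 𝟙 _) : Nonempty ((kernelSequence p).map
      (HomologicalComplex.eval (ModuleCat.{u} R) (ComplexShape.up ℤ) i)).Splitting := by
  obtain ⟨s, hs⟩ := h
  refine ⟨ShortComplex.Splitting.ofExactOfSection _ ((ShortComplex.exact_kernel p).map _) s hs ?_⟩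
  exact inferInstanceAs (Mono ((kernel.ι p).f i))

/-- The degreewise splittings make each kernel a termwise retract of a bounded below complex of pure
injectives, hence itself such a complex. -/
lemma isSpecialInverseSystem_of_section {S : ℕᵒᵖ ⥤ Cplx R}
    (hb : ∀ n, IsBoundedBelow (S.obj n)) (hS : ∀ n i, IsPI ((S.obj n).X i))
    (hsec : ∀ (n : ℕ) (i : ℤ), ∃ s, s ≫ (transition S n).f i = 𝟙 _) :
    IsSpecialInverseSystem IsKPureInjective S where
  zero := (isKPI_of_isBoundedBelow (hb _) (hS _)).isKPureInjective
  surjective n i := by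
    obtain ⟨s, hs⟩ := hsec n i
    exact fun y ↦ ⟨s y, ConcreteCategory.congr_hom hs y⟩
  kernel_mem n := by
    have σ (i : ℤ) := (nonempty_splitting_kernelSequence _ i (hsec n i)).some
    obtain ⟨a, ha⟩ := hb (Opposite.op (n + 1))
    refine (isKPI_of_isBoundedBelow ⟨a, fun i hi ↦ ?_⟩ fun i ↦ ?_).isKPureInjective
    · exact IsZero.of_mono ((kernel.ι (transition S n)).f i) (ha i hi)
    · exact (hS (Opposite.op (n + 1)) i).of_retract _ _ (σ i).f_r
  semiSplit n i := nonempty_splitting_kernelSequence _ i (hsec n i)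

end Main
end PureRes

theorem mainTheorem1 {R : Type u} [CommRing R] (M : CochainComplex (ModuleCat.{u} R) ℤ) :
    ∃ (I : CochainComplex (ModuleCat.{u} R) ℤ) (g : M ⟶ I),
      PureRes.IsPureInjectiveResolution g ∧
      ∃ (S : ℕᵒᵖ ⥤ CochainComplex (ModuleCat.{u} R) ℤ) (f : PureRes.truncSystem M ⟶ S)
        (p : (Functor.const ℕᵒᵖ).obj I ⟶ S),
        PureRes.IsSpecialInverseSystem PureRes.IsKPureInjective S ∧
        (∀ n : ℕᵒᵖ, PureRes.IsBoundedBelow (S.obj n) ∧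
          PureRes.IsPureInjectiveResolution (f.app n)) ∧
        Nonempty (IsLimit (Cone.mk I p)) ∧
        ∀ n : ℕᵒᵖ, g ≫ p.app n = M.πTruncGE (-(n.unop : ℤ)) ≫ f.app n := by
  obtain ⟨S, f, hb, hS, hf, hsec⟩ := PureRes.exists_resolution_tower (PureRes.truncSystem M)
    fun n ↦ ⟨-(n.unop : ℤ), fun i hi ↦
      (M.truncGE (-(n.unop : ℤ))).isZero_of_isStrictlyGE (-(n.unop : ℤ)) i hi⟩
  have hK (n) : PureRes.IsKPI (S.obj n) := PureRes.isKPI_of_isBoundedBelow (hb n) (hS n)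
  let π : (Functor.const ℕᵒᵖ).obj M ⟶ PureRes.truncSystem M :=
    { app n := M.πTruncGE (-(n.unop : ℤ))
      naturality _ _ h := (Category.id_comp _).trans
        (PureRes.π_truncTransition M (by have := h.unop.le; omega)).symm }
  let g : M ⟶ limit S := limit.lift S (Cone.mk M (π ≫ f))
  have hg (n : ℕᵒᵖ) : g ≫ (limit.cone S).π.app n = M.πTruncGE (-(n.unop : ℤ)) ≫ f.app n :=
    limit.lift_π _ _
  refine ⟨limit S, g, ⟨fun i ↦ ?_, ?_, ?_⟩, S, f, (limit.cone S).π,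
    PureRes.isSpecialInverseSystem_of_section hb hS hsec, fun n ↦ ⟨hb n, ⟨fun i ↦
      (hS n i).isPureInjective, (hf n).isPureQuasiIso, (hK n).isKPureInjective⟩⟩,
    ⟨limit.isLimit S⟩, hg⟩
  · refine PureRes.IsPI.isPureInjective (PureRes.isPI_of_isLimit (isLimitOfPreserves
      (HomologicalComplex.eval (ModuleCat.{u} R) (ComplexShape.up ℤ) i) (limit.isLimit S))
      (fun n ↦ hS n i) fun n ↦ hsec n i)
  · exact (PureRes.isHomQuasiIso_of_isLimit M (limit.isLimit S) hsec f hf g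
      fun n ↦ hg (Opposite.op n)).isPureQuasiIso
  · exact (PureRes.isKPI_of_isLimit (limit.isLimit S) hK hsec).isKPureInjective
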